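/- Conventions. All topological spaces are Hausdorff, locally convex spaces are real, and $\mathbb N=\{1,2,\dots\}$. Let $E,F$ be locally convex spaces and $U\subseteq E$ open. A map $f:U\to F$ is $C^k$, $k\in\mathbb N_0\cup\{\infty\}$, if it is continuous, the iterated directional derivatives $d^jf(x)(h_1,\dots,h_j)=(\partial_{h_j}\cdots\partial_{h_1}f)(x)$ exist for all integers $1\le j\le k$, $x\in U$, $h_1,\dots,h_j\in E$, and all maps $d^jf:U\times E^j\to F$ are continuous; $C^\infty$-maps are called smooth. Manifolds modeled on locally convex spaces, $C^k$-maps between them, and Lie groups (smooth multiplication and inversion) are defined with this notion of $C^k$-map. A Fréchet–Lie group is a Lie group modeled on a Fréchet space. A Lie group $G$ with $\mathfrak g=T_{\mathbf 1}(G)$ is locally exponential if it has an exponential function $\exp_G$ (a smooth map $\exp_G:\mathfrak g\to G$ such that every curve $\gamma_x(t)=\exp_G(tx)$ is a one-parameter group with $\gamma_x'(0)=x$) that maps some open $0$-neighborhood in $\mathfrak g$ diffeomorphically onto an open subset of $G$. Theorem. Let $G$ be a locally exponential Fréchet–Lie group with exponential function $\exp_G:\mathfrak g\to G$, let $V$ be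 a metrizable locally convex space (not necessarily complete), and let $\pi:G\to \mathrm{GL}(V)$ be a representation for which the action $G\times V\to V$, $(g,v)\mapsto\pi(g)v$, is continuous. For $x\in\mathfrak g$ let $$\mathcal D_x=\Big\{v\in V:\ \overline{d\pi}(x)v:=\tfrac{d}{dt}\Big|_{t=0}\pi(\exp_G(tx))v\ \text{ exists}\Big\},$$ and put $\mathcal D^1=\bigcap_{x\in\mathfrak g}\mathcal D_x$, $\mathcal D^n=\{v\in\mathcal D^1:\ \overline{d\pi}(x)v\in\mathcal D^{n-1}\text{ for all }x\in\mathfrak g\}$ for $n>1$, and $\mathcal D^\infty=\bigcap_{n\in\mathbb N}\mathcal D^n$. Then for every $k\in\mathbb N\cup\{\infty\}$ $$\mathcal D^k=\{v\in V:\ \text{the orbit map } G\to V,\ g\mapsto\pi(g)v,\ \text{is a } C^k\text{-map}\}.$$ -/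

import Mathlib

open Set Filter Topology

/-! ### Differential calculus in locally convex spaces -/

/-- The curve `c : ℝ → F` is differentiable at `0` with derivative `y`:
`y = lim_{t → 0} (c t - c 0) / t`. -/
def HasDerivAtZero {F : Type*} [AddCommGroup F] [Module ℝ F] [TopologicalSpace F]
    (c : ℝ → F) (y : F) : Prop :=
  Tendsto (fun t : ℝ => t⁻¹ • (c t - c 0)) (𝓝[≠] 0) (𝓝 y)

/-- The derivative at `0` of a curve `c : ℝ → F` (meaningful when it exists). -/
noncomputable def derivAtZero {F : Type*} [AddCommGroup F] [Module ℝ F] [TopologicalSpace F]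
    (c : ℝ → F) : F :=
  limUnder (𝓝[≠] (0 : ℝ)) (fun t : ℝ => t⁻¹ • (c t - c 0))

/-- `f` has the directional derivative `y` at `x` in the direction `h`. -/
def HasDirDeriv {E F : Type*} [AddCommGroup E] [Module ℝ E]
    [AddCommGroup F] [Module ℝ F] [TopologicalSpace F]
    (f : E → F) (x h : E) (y : F) : Prop :=
  HasDerivAtZero (fun t : ℝ => f (x + t • h)) y

/-- `f` is a `C^k`-map on the open set `U` (`k ∈ ℕ ∪ {∞}`): it is continuous, the iterated
directional derivatives `d^j f(x)(h₁, …, h_j) = (∂_{h_j} ⋯ ∂_{h₁} f)(x)` exist for all `j ≤ k`,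
and all maps `d^j f : U × E^j → F` are continuous. Here `D j x h` is `d^j f(x)(h 0, …, h (j-1))`;
in a Hausdorff space `F` it is uniquely determined on `U` for `j ≤ k`. -/
def IsCkOn {E F : Type*} [AddCommGroup E] [Module ℝ E] [TopologicalSpace E]
    [AddCommGroup F] [Module ℝ F] [TopologicalSpace F]
    (k : ℕ∞) (f : E → F) (U : Set E) : Prop :=
  ∃ D : (j : ℕ) → E → (Fin j → E) → F,
    (∀ x ∈ U, ∀ h : Fin 0 → E, D 0 x h = f x) ∧
    (∀ j : ℕ, (j : ℕ∞) < k → ∀ x ∈ U, ∀ h : Fin (j + 1) → E,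
      HasDirDeriv (fun y => D j y (Fin.init h)) x (h (Fin.last j)) (D (j + 1) x h)) ∧
    (∀ j : ℕ, (j : ℕ∞) ≤ k →
      ContinuousOn (fun p : E × (Fin j → E) => D j p.1 p.2) (U ×ˢ univ))

/-! ### Manifolds and Lie groups modeled on locally convex spaces -/

/-- A map `f` between manifolds modeled on `E` and `F` is `C^k` on the open set `S`: it is
continuous there and all its local representatives in charts are `C^k`. -/
def IsCkMapOn (E F : Type*) [AddCommGroup E] [Module ℝ E] [TopologicalSpace E]
    [AddCommGroup F] [Module ℝ F] [TopologicalSpace F]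
    {M N : Type*} [TopologicalSpace M] [ChartedSpace E M] [TopologicalSpace N] [ChartedSpace F N]
    (k : ℕ∞) (f : M → N) (S : Set M) : Prop :=
  ContinuousOn f S ∧
  ∀ e ∈ atlas E M, ∀ e' ∈ atlas F N,
    IsCkOn k (fun x => e' (f (e.symm x))) (e.target ∩ e.symm ⁻¹' (S ∩ f ⁻¹' e'.source))

/-- A `C^k`-map between manifolds. -/
def IsCkMap (E F : Type*) [AddCommGroup E] [Module ℝ E] [TopologicalSpace E]
    [AddCommGroup F] [Module ℝ F] [TopologicalSpace F]
    {M N : Type*} [TopologicalSpace M] [ChartedSpace E M] [TopologicalSpace N] [ChartedSpace F N]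
    (k : ℕ∞) (f : M → N) : Prop :=
  IsCkMapOn E F k f univ

/-- The product of two manifolds modeled on `E`, as a manifold modeled on `E × E`. -/
@[reducible] def prodManifold (E : Type*) [TopologicalSpace E]
    (M : Type*) [TopologicalSpace M] [ChartedSpace E M] : ChartedSpace (E × E) (M × M) :=
  prodChartedSpace E M E M

/-- `G`, with its group structure and its atlas of charts with values in the locally convex
space `E`, is a Lie group: the changes of charts are smooth, and the multiplication and the
inversion are smooth maps. -/
class IsLocallyConvexLieGroup (E G : Type*) [AddCommGroup E] [Module ℝ E] [TopologicalSpace E]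
    [TopologicalSpace G] [ChartedSpace E G] [Group G] : Prop where
  smooth_transition : ∀ e ∈ atlas E G, ∀ e' ∈ atlas E G,
    IsCkOn ⊤ (fun x => e' (e.symm x)) (e.target ∩ e.symm ⁻¹' e'.source)
  smooth_mul : letI := prodManifold E G
    IsCkMap (E × E) E ⊤ (fun p : G × G => p.1 * p.2)
  smooth_inv : IsCkMap E E ⊤ (fun g : G => g⁻¹)

/-- `exp` is an exponential function of the Lie group `G`: a smooth map on `T_1(G)` such that each
curve `γ_x(t) = exp (t x)` is a one-parameter group with `γ_x'(0) = x`. The tangent space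
`T_1(G)` is identified with the model space `E` by means of the preferred chart `chartAt E 1`
at the identity, so that the velocity at `0` of a curve through `1` is read off in this chart. -/
structure IsExponentialFunction (E : Type*) {G : Type*} [AddCommGroup E] [Module ℝ E]
    [TopologicalSpace E] [TopologicalSpace G] [ChartedSpace E G] [Group G]
    (exp : E → G) : Prop where
  smooth : IsCkMap E E ⊤ exp
  map_add : ∀ (x : E) (s t : ℝ), exp ((s + t) • x) = exp (s • x) * exp (t • x)
  velocity : ∀ x : E, HasDerivAtZero (fun t : ℝ => chartAt E (1 : G) (exp (t • x))) x

/-- The Lie group `G` with exponential function `exp` is locally exponential: some open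
`0`-neighborhood is mapped by `exp` diffeomorphically onto an open subset of `G`. -/
structure IsLocallyExponential (E : Type*) {G : Type*} [AddCommGroup E] [Module ℝ E]
    [TopologicalSpace E] [TopologicalSpace G] [ChartedSpace E G] [Group G]
    (exp : E → G) : Prop where
  isExp : IsExponentialFunction E exp
  local_diffeo : ∃ φ : OpenPartialHomeomorph E G, (0 : E) ∈ φ.source ∧ EqOn φ exp φ.source ∧
    IsCkMapOn E E ⊤ φ φ.source ∧ IsCkMapOn E E ⊤ φ.symm φ.target

/-! ### Differentiable vectors -/

/-- The domain `𝒟_x` of the infinitesimal generator of `t ↦ π (exp (t x))`. -/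
def genDomain {E G V : Type*} [AddCommGroup E] [Module ℝ E] [Group G]
    [AddCommGroup V] [Module ℝ V] [TopologicalSpace V]
    (π : Representation ℝ G V) (exp : E → G) (x : E) : Set V :=
  {v | ∃ w, HasDerivAtZero (fun t : ℝ => π (exp (t • x)) v) w}

/-- The infinitesimal generator `v ↦ d/dt|_{t=0} π (exp (t x)) v`, meaningful on `𝒟_x`. -/
noncomputable def gen {E G V : Type*} [AddCommGroup E] [Module ℝ E] [Group G]
    [AddCommGroup V] [Module ℝ V] [TopologicalSpace V]
    (π : Representation ℝ G V) (exp : E → G) (x : E) (v : V) : V :=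
  derivAtZero (fun t : ℝ => π (exp (t • x)) v)

/-- The common domain `𝒟^n` of the `n`-fold products of the generators: `𝒟^1 = ⋂_x 𝒟_x`, and
`𝒟^n = {v ∈ 𝒟^1 | ∀ x, gen x v ∈ 𝒟^{n-1}}` for `n > 1`. (By convention, `𝒟^0 = V`.) -/
def commonDomain {E G V : Type*} [AddCommGroup E] [Module ℝ E] [Group G]
    [AddCommGroup V] [Module ℝ V] [TopologicalSpace V]
    (π : Representation ℝ G V) (exp : E → G) : ℕ → Set V
  | 0 => univ
  | 1 => ⋂ x : E, genDomain π exp x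
  | n + 2 => {v | v ∈ ⋂ x : E, genDomain π exp x ∧
      ∀ x : E, gen π exp x v ∈ commonDomain π exp (n + 1)}

/-- The set of `C^k`-vectors: those `v` whose orbit map `g ↦ π g v` is a `C^k`-map on the Lie
group `G` modeled on `E`. -/
def ckVectors (E : Type*) {G V : Type*} [AddCommGroup E] [Module ℝ E] [TopologicalSpace E]
    [TopologicalSpace G] [ChartedSpace E G] [Group G]
    [AddCommGroup V] [Module ℝ V] [TopologicalSpace V]
    (π : Representation ℝ G V) (k : ℕ∞) : Set V :=
  {v | IsCkMap E V k (fun g : G => π g v)}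

/-! If the orbit map of `v` is `C^(k+1)`, differentiating it along `t ↦ g * exp (t • x)` at `t = 0`
shows that the generator of `x` is defined at `v` and that the resulting vector has a `C^k` orbit
map (`IsHadamardCkFrom.gen`). Induction gives one inclusion.

The converse rests on linearity and continuity of the generators in `x`. For `v ∈ 𝒟^1`, the map `x ↦
gen π exp x v` is a pointwise limit of continuous difference quotients on the Baire space `E`. As
`V` is metrizable, this convergence is continuous at some point. Near `1`, products of exponentials
agree to first order with the exponential of the sum (`IsLocalLog.exists_exp_mul_exp`), which
transports the continuous convergence to every point and yields additivity (`gen_add_left`). The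
same Baire argument on `E^(m+1)` gives a continuity point of the multilinear map `(h₀, …, h_m) ↦
dπ(h_m) M(h₀, …, h_(m-1))`, and one such point suffices for a multilinear map to be continuous
(`exists_multilinearMap_gen`).

Differentiability then follows by induction on `k` for a larger class of functions
(`hadamardCk_orbit`): `x ↦ π (γ x) (M (a x))`, with `γ`, `a` smooth and `M` continuous multilinear
with values in `𝒟^k`. Its derivative is a sum of functions of the same type: one applies the
generator in the direction of the logarithmic derivative of `γ`, the others differentiate an
argument of `M`.

Calculus is done with Hadamard derivatives, where the direction may vary in the limit. The chain
rule is then immediate, and a mean value theorem based on Hahn–Banach, which needs no completeness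
of `V`, shows that the resulting `C^k` notion agrees with the given one (`isCkOn_iff_hadamardCk`).
-/

theorem tendsto_mul_const_nhdsNE_zero {a : ℝ} (ha : a ≠ 0) :
    Tendsto (fun t : ℝ => t * a) (𝓝[≠] 0) (𝓝[≠] 0) := by
  refine tendsto_nhdsWithin_iff.2 ⟨?_, ?_⟩
  · have : Tendsto (fun t : ℝ => t * a) (𝓝 0) (𝓝 (0 * a)) := Continuous.tendsto (by fun_prop) _
    rw [zero_mul] at this
    exact this.mono_left nhdsWithin_le_nhds
  · filter_upwards [self_mem_nhdsWithin] with t ht using mul_ne_zero ht ha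

theorem tendsto_one_div_add_atTop_nhdsNE_zero :
    Tendsto (fun n : ℕ => 1 / (n + 1 : ℝ)) atTop (𝓝[≠] 0) :=
  tendsto_nhdsWithin_iff.2 ⟨tendsto_one_div_add_atTop_nhds_zero_nat, .of_forall fun n => by
    have : (0 : ℝ) < 1 / (n + 1 : ℝ) := by positivity
    exact this.ne'⟩

/-! ### Mean value theorem -/

section MeanValue

variable {F : Type*} [AddCommGroup F] [Module ℝ F] [TopologicalSpace F]

/-- `c` has the derivative `y` at `s`. -/
def HasCurveDeriv (c : ℝ → F) (s : ℝ) (y : F) : Prop :=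
  Tendsto (fun t : ℝ => t⁻¹ • (c (s + t) - c s)) (𝓝[≠] 0) (𝓝 y)

theorem HasCurveDeriv.hasDerivAt_clm {c : ℝ → F} {s : ℝ} {y : F} (h : HasCurveDeriv c s y)
    (ℓ : F →L[ℝ] ℝ) : HasDerivAt (fun s => ℓ (c s)) (ℓ y) s := by
  rw [hasDerivAt_iff_tendsto_slope_zero]
  have := (ℓ.continuous.tendsto y).comp h
  refine this.congr fun t => ?_
  simp [Function.comp]

variable [IsTopologicalAddGroup F] [ContinuousSMul ℝ F]

/-- Replaces integration, which would need completeness. If the increment were outside `C`, a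
functional `ℓ` would separate it strictly from `C`, but the scalar mean value theorem for `ℓ ∘ c`
finds a derivative with the same value under `ℓ`. -/
theorem sub_mem_of_hasCurveDeriv_mem {c c' : ℝ → F} {C : Set F} (hC : Convex ℝ C)
    (hCo : IsOpen C) (h : ∀ s ∈ Icc (0 : ℝ) 1, HasCurveDeriv c s (c' s))
    (hmem : ∀ s ∈ Icc (0 : ℝ) 1, c' s ∈ C) : c 1 - c 0 ∈ C := by
  by_contra hn
  obtain ⟨ℓ, hℓ⟩ := geometric_hahn_banach_open_point hC hCo hn
  have hd : ∀ s ∈ Icc (0 : ℝ) 1, HasDerivAt (fun s => ℓ (c s)) (ℓ (c' s)) s := fun s hs =>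
    (h s hs).hasDerivAt_clm ℓ
  obtain ⟨s, hs, hs'⟩ := exists_hasDerivAt_eq_slope (fun s => ℓ (c s)) (fun s => ℓ (c' s))
    zero_lt_one (fun s hs => (hd s hs).continuousAt.continuousWithinAt)
    (fun s hs => hd s (Ioo_subset_Icc_self hs))
  have := hℓ _ (hmem s (Ioo_subset_Icc_self hs))
  simp only [map_sub, hs'] at this
  simp at this

/-- The filter `l ×ˢ 𝓟 (Icc 0 1)` expresses convergence uniform in `s`; the mean value theorem
applies to the translates `y + C` of convex open `0`-neighborhoods. -/
theorem tendsto_sub_of_hasCurveDeriv [LocallyConvexSpace ℝ F] {α : Type*} {l : Filter α} {c c' : α → ℝ → F} {y : F}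
    (h : ∀ᶠ a in l, ∀ s ∈ Icc (0 : ℝ) 1, HasCurveDeriv (c a) s (c' a s))
    (hy : Tendsto (fun p : α × ℝ => c' p.1 p.2) (l ×ˢ 𝓟 (Icc 0 1)) (𝓝 y)) :
    Tendsto (fun a => c a 1 - c a 0) l (𝓝 y) := by
  have h0 : Tendsto (fun a => (c a 1 - c a 0) - y) l (𝓝 0) := by
    rw [(LocallyConvexSpace.convex_open_basis_zero ℝ F).tendsto_right_iff]
    rintro C ⟨hC0, hCo, hC⟩
    have hCy : (fun z => z - y) ⁻¹' C ∈ 𝓝 y :=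
      (hCo.preimage (continuous_id.sub continuous_const)).mem_nhds (by simpa using hC0)
    have hev := hy hCy
    rw [mem_map, mem_prod_principal] at hev
    filter_upwards [h, hev] with a ha hea
    have hconv : Convex ℝ ((fun z => z - y) ⁻¹' C) := by
      simpa [sub_eq_add_neg] using hC.translate_preimage_left (-y)
    exact sub_mem_of_hasCurveDeriv_mem hconv
      (hCo.preimage (continuous_id.sub continuous_const)) ha hea
  simpa using h0.add_const y

theorem tendsto_smul_zero_of_Icc {X : Type*} [AddCommGroup X] [Module ℝ X] [TopologicalSpace X]
    [ContinuousSMul ℝ X] {α : Type*} {l : Filter α} {z : α → X} (hz : Tendsto z l (𝓝 0)) :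
    Tendsto (fun p : α × ℝ => p.2 • z p.1) (l ×ˢ 𝓟 (Icc 0 1)) (𝓝 0) := by
  rw [(nhds_basis_balanced ℝ X).tendsto_right_iff]
  rintro W ⟨hW, hWb⟩
  have h1 : ∀ᶠ p : α × ℝ in l ×ˢ 𝓟 (Icc 0 1), z p.1 ∈ W :=
    tendsto_fst.eventually (p := fun a => z a ∈ W) (hz hW)
  have h2 : ∀ᶠ p : α × ℝ in l ×ˢ 𝓟 (Icc 0 1), p.2 ∈ Icc (0 : ℝ) 1 :=
    tendsto_snd.eventually (mem_principal_self _)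
  filter_upwards [h1, h2] with p hp1 hp2
  exact hWb.smul_mem (by rw [Real.norm_eq_abs, abs_of_nonneg hp2.1]; exact hp2.2) hp1

end MeanValue

/-! ### Hadamard derivatives -/

section Hadamard

theorem eventually_fst_ne_zero {X : Type*} (l : Filter X) : ∀ᶠ p : ℝ × X in 𝓝[≠] 0 ×ˢ l, p.1 ≠ 0 :=
  tendsto_fst.eventually (eventually_mem_nhdsWithin)

variable {X Y Z : Type*} [AddCommGroup X] [Module ℝ X] [TopologicalSpace X]
  [AddCommGroup Y] [Module ℝ Y] [TopologicalSpace Y]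
  [AddCommGroup Z] [Module ℝ Z] [TopologicalSpace Z]

/-- `f` has the Hadamard derivative `y` at `x` in the direction `h`. -/
def HasHadamardDeriv (f : X → Y) (x h : X) (y : Y) : Prop :=
  Tendsto (fun p : ℝ × X => p.1⁻¹ • (f (x + p.1 • p.2) - f x)) (𝓝[≠] 0 ×ˢ 𝓝 h) (𝓝 y)

/-- The derivative of `f` as a map on pairs (point, direction). -/
noncomputable def hadamardDeriv (f : X → Y) (p : X × X) : Y :=
  limUnder (𝓝[≠] (0 : ℝ)) (fun t : ℝ => t⁻¹ • (f (p.1 + t • p.2) - f p.1))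

theorem HasHadamardDeriv.tendsto {f : X → Y} {x h : X} {y : Y} (hf : HasHadamardDeriv f x h y) :
    Tendsto (fun t : ℝ => t⁻¹ • (f (x + t • h) - f x)) (𝓝[≠] 0) (𝓝 y) :=
  Tendsto.comp hf (tendsto_id.prodMk tendsto_const_nhds)

theorem HasHadamardDeriv.hasDirDeriv {f : X → Y} {x h : X} {y : Y}
    (hf : HasHadamardDeriv f x h y) : HasDirDeriv f x h y := by
  simpa [HasDirDeriv, HasDerivAtZero] using hf.tendsto

theorem HasHadamardDeriv.unique [T2Space Y] {f : X → Y} {x h : X} {y y' : Y}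
    (hf : HasHadamardDeriv f x h y) (hf' : HasHadamardDeriv f x h y') : y = y' :=
  tendsto_nhds_unique hf.tendsto hf'.tendsto

theorem HasHadamardDeriv.hadamardDeriv_eq [T2Space Y] {f : X → Y} {x h : X} {y : Y}
    (hf : HasHadamardDeriv f x h y) : hadamardDeriv f (x, h) = y :=
  hf.tendsto.limUnder_eq

theorem tendsto_add_smul [IsTopologicalAddGroup X] [ContinuousSMul ℝ X] (x h : X) :
    Tendsto (fun p : ℝ × X => x + p.1 • p.2) (𝓝[≠] 0 ×ˢ 𝓝 h) (𝓝 x) := by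
  have : Tendsto (fun p : ℝ × X => x + p.1 • p.2) (𝓝 0 ×ˢ 𝓝 h) (𝓝 (x + (0 : ℝ) • h)) := by
    rw [← nhds_prod_eq]
    exact Continuous.tendsto (by fun_prop) _
  rw [zero_smul, add_zero] at this
  exact this.mono_left (prod_mono nhdsWithin_le_nhds le_rfl)

theorem HasHadamardDeriv.congr [IsTopologicalAddGroup X] [ContinuousSMul ℝ X] {f g : X → Y}
    {x h : X} {y : Y} (hf : HasHadamardDeriv f x h y) (hfg : f =ᶠ[𝓝 x] g) :
    HasHadamardDeriv g x h y := by
  refine Tendsto.congr' ?_ hf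
  filter_upwards [tendsto_add_smul x h hfg] with p hp
  have hp : f (x + p.1 • p.2) = g (x + p.1 • p.2) := hp
  rw [hp, hfg.self_of_nhds]

/-- Since the direction may vary, `f (x + t • h') = f x + t • k` with `k → y` can be substituted
into the limit for `g`; there is no remainder to estimate. -/
theorem HasHadamardDeriv.comp {f : X → Y} {g : Y → Z} {x h : X} {y : Y} {z : Z}
    (hg : HasHadamardDeriv g (f x) y z) (hf : HasHadamardDeriv f x h y) :
    HasHadamardDeriv (g ∘ f) x h z := by
  have := Tendsto.comp hg (tendsto_fst.prodMk hf)
  refine this.congr' ?_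
  filter_upwards [eventually_fst_ne_zero (𝓝 h)] with p hp
  simp [Function.comp, smul_smul, mul_inv_cancel₀ hp]

theorem HasHadamardDeriv.prodMk {f : X → Y} {g : X → Z} {x h : X} {y : Y} {z : Z}
    (hf : HasHadamardDeriv f x h y) (hg : HasHadamardDeriv g x h z) :
    HasHadamardDeriv (fun x => (f x, g x)) x h (y, z) :=
  Tendsto.prodMk_nhds hf hg

theorem ContinuousLinearMap.hasHadamardDeriv (L : X →L[ℝ] Y) (x h : X) :
    HasHadamardDeriv L x h (L h) := by
  have : Tendsto (fun p : ℝ × X => L p.2) (𝓝[≠] 0 ×ˢ 𝓝 h) (𝓝 (L h)) :=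
    (L.continuous.tendsto h).comp tendsto_snd
  refine this.congr' ?_
  filter_upwards [eventually_fst_ne_zero (𝓝 h)] with p hp
  simp [smul_smul, inv_mul_cancel₀ hp]

theorem hasHadamardDeriv_const (y : Y) (x h : X) :
    HasHadamardDeriv (fun _ : X => y) x h 0 := by
  simp [HasHadamardDeriv, tendsto_const_nhds]

theorem HasHadamardDeriv.add [ContinuousAdd Y] {f g : X → Y} {x h : X} {y z : Y}
    (hf : HasHadamardDeriv f x h y) (hg : HasHadamardDeriv g x h z) :
    HasHadamardDeriv (fun x => f x + g x) x h (y + z) := by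
  refine (Tendsto.add hf hg).congr fun p => ?_
  rw [← smul_add, sub_add_sub_comm]

theorem HasHadamardDeriv.smul_dir
    [ContinuousSMul ℝ Y] {f : X → Y} {x h : X} {y : Y}
    (hf : HasHadamardDeriv f x h y) {a : ℝ} (ha : a ≠ 0) :
    Tendsto (fun t : ℝ => t⁻¹ • (f (x + t • a • h) - f x)) (𝓝[≠] 0) (𝓝 (a • y)) := by
  have hm := tendsto_mul_const_nhdsNE_zero ha
  refine ((hf.tendsto.comp hm).const_smul a).congr fun t => ?_
  simp only [Function.comp, smul_smul, mul_inv]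
  congr 1
  field_simp

/-- The Hadamard derivative exists if directional derivatives exist near the point and are
continuous. -/
theorem hasHadamardDeriv_of_hasDirDeriv [IsTopologicalAddGroup X] [ContinuousSMul ℝ X]
    [IsTopologicalAddGroup Y] [ContinuousSMul ℝ Y] [LocallyConvexSpace ℝ Y]
    {P : Type*} {l : Filter P} {f : P → X → Y} {f' : P → X × X → Y} {U : Set X} (hU : IsOpen U)
    (hf : ∀ᶠ a in l, ∀ x ∈ U, ∀ h, HasDirDeriv (f a) x h (f' a (x, h))) {x h : X} (hx : x ∈ U)
    {y : Y} {u : P → X} {q : P → X} {t : P → ℝ} (ht : Tendsto t l (𝓝[≠] 0))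
    (hu : Tendsto u l (𝓝 x)) (hq : Tendsto q l (𝓝 h))
    (hy : Tendsto (fun p : P × X × X => f' p.1 p.2) (l ×ˢ 𝓝 (x, h)) (𝓝 y)) :
    Tendsto (fun a => (t a)⁻¹ • (f a (u a + t a • q a) - f a (u a))) l (𝓝 y) := by
  have htq : Tendsto (fun a => t a • q a) l (𝓝 0) := by
    have := (tendsto_nhds_of_tendsto_nhdsWithin ht).smul hq
    rwa [zero_smul] at this
  have hbase : Tendsto (fun p : P × ℝ => u p.1 + p.2 • (t p.1 • q p.1)) (l ×ˢ 𝓟 (Icc 0 1))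
      (𝓝 x) := by
    simpa using (hu.comp tendsto_fst).add (tendsto_smul_zero_of_Icc htq)
  have hb := hbase (hU.mem_nhds hx)
  rw [mem_map, mem_prod_principal] at hb
  -- Run through the segment from `u a` to `u a + t a • q a`. The function, base point and direction
  -- all depend on the parameter `a`; additivity of derivatives and joint differentiability both use
  -- this freedom.
  have := tendsto_sub_of_hasCurveDeriv (l := l)
    (c := fun a s => (t a)⁻¹ • f a (u a + s • (t a • q a)))
    (c' := fun a s => f' a (u a + s • (t a • q a), q a)) (y := y) ?_ ?_
  · refine this.congr fun a => ?_
    simp [smul_sub]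
  · filter_upwards [hf, hb, tendsto_nhdsWithin_iff.1 ht |>.2] with a ha hba hta s hs
    have hta : t a ≠ 0 := hta
    have h1 := ha _ (hba s hs) (q a)
    unfold HasDirDeriv HasDerivAtZero at h1
    have hm := tendsto_mul_const_nhdsNE_zero hta
    refine (h1.comp hm).congr fun r => ?_
    simp only [Function.comp, ← smul_sub, smul_smul, mul_inv, zero_smul, add_zero]
    congr 3
    rw [add_assoc, ← add_smul, add_mul]
  · have hh := hy.comp (tendsto_fst.prodMk (hbase.prodMk_nhds (hq.comp tendsto_fst)))
    exact hh

end Hadamard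

/-! ### `C^k`-maps by iterated Hadamard derivatives -/

section HadamardCk

universe u v w

/-- `f` is continuous on `U` and has `k` continuous iterated Hadamard derivatives there. -/
def HadamardCk {Y : Type v} [AddCommGroup Y] [Module ℝ Y] [TopologicalSpace Y] :
    ℕ → ∀ {X : Type u} [AddCommGroup X] [Module ℝ X] [TopologicalSpace X], (X → Y) → Set X → Prop
  | 0, _, _, _, _, f, U => ContinuousOn f U
  | k + 1, _, _, _, _, f, U => ContinuousOn f U ∧
      (∀ x ∈ U, ∀ h, HasHadamardDeriv f x h (hadamardDeriv f (x, h))) ∧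
      HadamardCk k (hadamardDeriv f) (U ×ˢ univ)

namespace HadamardCk

variable {X : Type u} {Y : Type v} {Z : Type w}
  [AddCommGroup X] [Module ℝ X] [TopologicalSpace X]
  [AddCommGroup Y] [Module ℝ Y] [TopologicalSpace Y]
  [AddCommGroup Z] [Module ℝ Z] [TopologicalSpace Z]

theorem continuousOn : ∀ {k : ℕ} {f : X → Y} {U : Set X}, HadamardCk k f U → ContinuousOn f U
  | 0, _, _, hf => hf
  | _ + 1, _, _, hf => hf.1

theorem hasHadamardDeriv {k : ℕ} {f : X → Y} {U : Set X} (hf : HadamardCk (k + 1) f U) {x : X}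
    (hx : x ∈ U) (h : X) : HasHadamardDeriv f x h (hadamardDeriv f (x, h)) :=
  hf.2.1 x hx h

theorem deriv {k : ℕ} {f : X → Y} {U : Set X} (hf : HadamardCk (k + 1) f U) :
    HadamardCk k (hadamardDeriv f) (U ×ˢ univ) :=
  hf.2.2

theorem mono : ∀ {k : ℕ} {X : Type u} [AddCommGroup X] [Module ℝ X] [TopologicalSpace X]
    {f : X → Y} {U U' : Set X}, HadamardCk k f U → U' ⊆ U → HadamardCk k f U'
  | 0, _, _, _, _, _, _, _, hf, h => ContinuousOn.mono hf h
  | _ + 1, _, _, _, _, _, _, _, hf, h => ⟨hf.1.mono h, fun x hx => hf.2.1 x (h hx),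
      mono hf.2.2 (prod_mono h Subset.rfl)⟩

theorem of_succ : ∀ {k : ℕ} {X : Type u} [AddCommGroup X] [Module ℝ X] [TopologicalSpace X]
    {f : X → Y} {U : Set X}, HadamardCk (k + 1) f U → HadamardCk k f U
  | 0, _, _, _, _, _, _, hf => hf.1
  | _ + 1, _, _, _, _, _, _, hf => ⟨hf.1, hf.2.1, of_succ hf.2.2⟩

theorem of_local : ∀ {k : ℕ} {X : Type u} [AddCommGroup X] [Module ℝ X] [TopologicalSpace X]
    {f : X → Y} {U : Set X},
    (∀ x ∈ U, ∃ W, IsOpen W ∧ x ∈ W ∧ HadamardCk k f (W ∩ U)) → HadamardCk k f U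
  | 0, _, _, _, _, f, U, hf => fun x hx => by
      obtain ⟨W, hW, hxW, h⟩ := hf x hx
      exact (continuousWithinAt_inter' (mem_nhdsWithin_of_mem_nhds (hW.mem_nhds hxW))).1
        (inter_comm W U ▸ h x ⟨hxW, hx⟩)
  | k + 1, _, _, _, _, f, U, hf => by
      refine ⟨?_, fun x hx h => ?_, ?_⟩
      · exact of_local (k := 0) fun x hx =>
          let ⟨W, hW, hxW, h⟩ := hf x hx; ⟨W, hW, hxW, h.continuousOn⟩
      · obtain ⟨W, hW, hxW, hfW⟩ := hf x hx
        exact hfW.hasHadamardDeriv ⟨hxW, hx⟩ h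
      · refine of_local fun p hp => ?_
        obtain ⟨W, hW, hxW, hfW⟩ := hf p.1 hp.1
        refine ⟨W ×ˢ univ, hW.prod isOpen_univ, ⟨hxW, trivial⟩, ?_⟩
        refine hfW.deriv.mono ?_
        rintro ⟨x, h⟩ ⟨⟨h1, -⟩, ⟨h2, -⟩⟩
        exact ⟨⟨h1, h2⟩, trivial⟩

theorem congr [T2Space Y] : ∀ {k : ℕ} {X : Type u} [AddCommGroup X] [Module ℝ X]
    [TopologicalSpace X] [IsTopologicalAddGroup X] [ContinuousSMul ℝ X]
    {f g : X → Y} {U : Set X}, IsOpen U → HadamardCk k f U → EqOn f g U → HadamardCk k g U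
  | 0, _, _, _, _, _, _, _, _, _, _, hf, h => ContinuousOn.congr hf h.symm
  | k + 1, _, _, _, _, _, _, f, g, U, hU, hf, h => by
      have key : ∀ x ∈ U, ∀ v, HasHadamardDeriv g x v (hadamardDeriv f (x, v)) := fun x hx v =>
        (hf.hasHadamardDeriv hx v).congr (h.eventuallyEq_of_mem (hU.mem_nhds hx))
      have heq : EqOn (hadamardDeriv f) (hadamardDeriv g) (U ×ˢ univ) := fun p hp =>
        (key p.1 hp.1 p.2).hadamardDeriv_eq.symm
      exact ⟨hf.1.congr h.symm, fun x hx v => by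
        rw [← heq ⟨hx, trivial⟩]; exact key x hx v,
        congr (hU.prod isOpen_univ) hf.2.2 heq⟩

variable [IsTopologicalAddGroup X] [ContinuousSMul ℝ X]

/-- Any function computing the Hadamard derivatives on the open set may replace the chosen limit
`hadamardDeriv f`, so explicit derivative formulas can be used in inductions. -/
theorem succ_of [T2Space Y] {k : ℕ} {f : X → Y} {U : Set X} (hU : IsOpen U)
    (hc : ContinuousOn f U) (f' : X × X → Y)
    (hf : ∀ x ∈ U, ∀ h, HasHadamardDeriv f x h (f' (x, h))) (hf' : HadamardCk k f' (U ×ˢ univ)) :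
    HadamardCk (k + 1) f U := by
  have heq : EqOn f' (hadamardDeriv f) (U ×ˢ univ) := fun p hp =>
    (hf p.1 hp.1 p.2).hadamardDeriv_eq.symm
  refine ⟨hc, fun x hx v => ?_, hf'.congr (hU.prod isOpen_univ) heq⟩
  rw [← heq ⟨hx, trivial⟩]; exact hf x hx v

theorem const [T2Space Y] : ∀ (k : ℕ) {X : Type u} [AddCommGroup X] [Module ℝ X]
    [TopologicalSpace X] [IsTopologicalAddGroup X] [ContinuousSMul ℝ X] (y : Y) {U : Set X},
    IsOpen U → HadamardCk k (fun _ : X => y) U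
  | 0, _, _, _, _, _, _, _, _, _ => continuousOn_const
  | k + 1, _, _, _, _, _, _, y, _, hU => succ_of hU continuousOn_const _
      (fun x _ h => hasHadamardDeriv_const y x h) (const k 0 (hU.prod isOpen_univ))

theorem clm [T2Space Y] : ∀ (k : ℕ) {X : Type u} [AddCommGroup X] [Module ℝ X]
    [TopologicalSpace X] [IsTopologicalAddGroup X] [ContinuousSMul ℝ X] (L : X →L[ℝ] Y) {U : Set X},
    IsOpen U → HadamardCk k L U
  | 0, _, _, _, _, _, _, L, _, _ => L.continuous.continuousOn
  | k + 1, X, _, _, _, _, _, L, _, hU => succ_of hU L.continuous.continuousOn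
      (L.comp (ContinuousLinearMap.snd ℝ X X)) (fun x _ h => L.hasHadamardDeriv x h)
      (clm k _ (hU.prod isOpen_univ))

theorem prodMk [T2Space Y] [T2Space Z] : ∀ {k : ℕ} {X : Type u} [AddCommGroup X] [Module ℝ X]
    [TopologicalSpace X] [IsTopologicalAddGroup X] [ContinuousSMul ℝ X]
    {f : X → Y} {g : X → Z} {U : Set X}, IsOpen U → HadamardCk k f U → HadamardCk k g U →
    HadamardCk k (fun x => (f x, g x)) U
  | 0, _, _, _, _, _, _, _, _, _, _, hf, hg => ContinuousOn.prodMk hf hg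
  | _ + 1, _, _, _, _, _, _, _, _, _, hU, hf, hg => succ_of hU (hf.1.prodMk hg.1)
      (fun p => (hadamardDeriv _ p, hadamardDeriv _ p))
      (fun _ hx h => (hf.hasHadamardDeriv hx h).prodMk (hg.hasHadamardDeriv hx h))
      (prodMk (hU.prod isOpen_univ) hf.2.2 hg.2.2)

/-- Proved before the general chain rule, whose induction needs it for `f ∘ fst`; here the
derivative is again a composition with a linear map. -/
theorem comp_clm [T2Space Y] : ∀ {k : ℕ} {X : Type u} [AddCommGroup X] [Module ℝ X]
    [TopologicalSpace X] {W : Type w} [AddCommGroup W] [Module ℝ W]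
    [TopologicalSpace W] [IsTopologicalAddGroup W] [ContinuousSMul ℝ W]
    {f : X → Y} {U : Set X} {U' : Set W}, IsOpen U' →
    HadamardCk k f U → ∀ L : W →L[ℝ] X, MapsTo L U' U → HadamardCk k (fun x => f (L x)) U'
  | 0, _, _, _, _, _, _, _, _, _, _, _, _, _, _, hf, L, h =>
      ContinuousOn.comp hf L.continuous.continuousOn h
  | _ + 1, _, _, _, _, _, _, _, _, _, _, f, _, _, hU', hf, L, h =>
      succ_of hU' (hf.1.comp L.continuous.continuousOn h)
        (fun p => hadamardDeriv f (L.prodMap L p))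
        (fun x hx v => (hf.hasHadamardDeriv (h hx) (L v)).comp (L.hasHadamardDeriv x v))
        (comp_clm (hU'.prod isOpen_univ) hf.2.2 (L.prodMap L) fun _ hp => ⟨h hp.1, trivial⟩)

/-- The derivative is `hadamardDeriv g` composed with `(x, v) ↦ (f x, hadamardDeriv f (x, v))`, a
composition of one order less. -/
theorem comp [T2Space Z] : ∀ {k : ℕ} {X : Type u} [AddCommGroup X] [Module ℝ X]
    [TopologicalSpace X] [IsTopologicalAddGroup X] [ContinuousSMul ℝ X]
    {Y : Type v} [AddCommGroup Y] [Module ℝ Y]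
    [TopologicalSpace Y] [IsTopologicalAddGroup Y] [ContinuousSMul ℝ Y] [T2Space Y]
    {g : Y → Z} {f : X → Y} {U : Set X} {W : Set Y}, IsOpen U → HadamardCk k g W →
    HadamardCk k f U → MapsTo f U W → HadamardCk k (g ∘ f) U
  | 0, _, _, _, _, _, _, _, _, _, _, _, _, _, _, _, _, _, _, hg, hf, h =>
      ContinuousOn.comp (β := _) hg hf h
  | k + 1, X, _, _, _, _, _, Y, _, _, _, _, _, _, g, f, U, W, hU, hg, hf, h => by
      refine succ_of hU (hg.1.comp hf.1 h) (hadamardDeriv g ∘ fun p => (f p.1, hadamardDeriv f p))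
        (fun x hx v => (hg.hasHadamardDeriv (h hx) _).comp (hf.hasHadamardDeriv hx v)) ?_
      have hU' : IsOpen (U ×ˢ (univ : Set X)) := hU.prod isOpen_univ
      have hf1 : HadamardCk k (fun p : X × X => f p.1) (U ×ˢ univ) :=
        comp_clm hU' hf.of_succ (ContinuousLinearMap.fst ℝ X X) fun p hp => hp.1
      exact comp hU' hg.2.2 (prodMk hU' hf1 hf.2.2) fun p hp => ⟨h hp.1, trivial⟩

variable [IsTopologicalAddGroup Y] [ContinuousSMul ℝ Y] [T2Space Y]

theorem clm_comp [T2Space Z] (L : Y →L[ℝ] Z) {k : ℕ} {f : X → Y} {U : Set X} (hU : IsOpen U)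
    (hf : HadamardCk k f U) : HadamardCk k (fun x => L (f x)) U :=
  (clm k L isOpen_univ).comp hU hf (mapsTo_univ _ _)

theorem add {k : ℕ} {f g : X → Y} {U : Set X} (hU : IsOpen U)
    (hf : HadamardCk k f U) (hg : HadamardCk k g U) : HadamardCk k (fun x => f x + g x) U :=
  (hf.prodMk hU hg).clm_comp (ContinuousLinearMap.fst ℝ Y Y + ContinuousLinearMap.snd ℝ Y Y) hU

theorem sum {ι : Type*} (s : Finset ι) {k : ℕ} {f : ι → X → Y} {U : Set X} (hU : IsOpen U)
    (hf : ∀ i ∈ s, HadamardCk k (f i) U) : HadamardCk k (fun x => ∑ i ∈ s, f i x) U := by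
  classical
  induction s using Finset.induction_on with
  | empty => simpa using const k (0 : Y) hU
  | insert i s hi ih =>
    simp only [Finset.sum_insert hi]
    exact add hU (hf i (Finset.mem_insert_self i s))
      (ih fun j hj => hf j (Finset.mem_insert_of_mem hj))

/-- Go from `x` to `x + t • h` and then to `x + t • h + t • h'`; continuity of the derivative
controls the second quotient despite its moving base point. -/
theorem hadamardDeriv_add {f : X → Y} {U : Set X} [LocallyConvexSpace ℝ Y] (hU : IsOpen U)
    (hf : HadamardCk 1 f U) {x : X} (hx : x ∈ U) (h h' : X) :
    hadamardDeriv f (x, h + h') = hadamardDeriv f (x, h) + hadamardDeriv f (x, h') := by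
  have ht : Tendsto (fun t : ℝ => t) (𝓝[≠] 0) (𝓝[≠] 0) := tendsto_id
  have hu : Tendsto (fun t : ℝ => x + t • h) (𝓝[≠] 0) (𝓝 x) :=
    (tendsto_add_smul x h).comp (tendsto_id.prodMk tendsto_const_nhds)
  have h1 := hasHadamardDeriv_of_hasDirDeriv (l := 𝓝[≠] (0 : ℝ)) (f := fun _ => f)
    (f' := fun _ => hadamardDeriv f) hU
    (.of_forall fun _ x hx v => (hf.hasHadamardDeriv hx v).hasDirDeriv) hx (h := h') ht
    hu tendsto_const_nhds
    (((hf.deriv.continuousOn.continuousAt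
      ((hU.prod isOpen_univ).mem_nhds ⟨hx, trivial⟩)).tendsto).comp tendsto_snd)
  have h2 := (hf.hasHadamardDeriv hx h).tendsto.add h1
  refine tendsto_nhds_unique (hf.hasHadamardDeriv hx (h + h')).tendsto (h2.congr fun t => ?_)
  rw [← smul_add, add_comm, sub_add_sub_cancel, add_assoc, smul_add t h h']

end HadamardCk

end HadamardCk

/-! ### Continuity and differentiability of multilinear maps -/

namespace MultilinearMap

variable {m : ℕ} {E V : Type*} [AddCommGroup E] [Module ℝ E] [TopologicalSpace E]
  [IsTopologicalAddGroup E]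
  [AddCommGroup V] [Module ℝ V] [TopologicalSpace V] [IsTopologicalAddGroup V]

/-- Slots are sent to `0` one at a time: an entry `y i` is the difference of the entries `z i + y i`
and `z i`, and both corresponding values have the same limit by induction. For all slots this gives
continuity at `0`. -/
theorem tendsto_piecewise_of_continuousAt (M : MultilinearMap ℝ (fun _ : Fin m => E) V)
    {a : Fin m → E} (ha : ContinuousAt M a) {α : Type*} {l : Filter α} (s : Finset (Fin m)) :
    ∀ {y z : α → Fin m → E}, Tendsto y l (𝓝 0) → Tendsto z l (𝓝 a) →
      Tendsto (fun i => M (s.piecewise (y i) (z i))) l (𝓝 (if s = ∅ then M a else 0)) := by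
  induction s using Finset.induction_on with
  | empty => intro y z _ hz; simpa [Function.comp_def] using ha.tendsto.comp hz
  | insert i s hi ih =>
    intro y z hy hz
    have hyi : Tendsto (fun j => y j i) l (𝓝 0) := (tendsto_pi_nhds.1 hy) i
    have hzi : Tendsto (fun j => z j i) l (𝓝 (a i)) := (tendsto_pi_nhds.1 hz) i
    have h1 := ih hy (z := fun j => Function.update (z j) i (z j i + y j i)) (by
      have := hz.update i (hzi.add hyi)
      simpa using this)
    have h2 := ih hy hz
    have h3 := h1.sub h2
    rw [sub_self] at h3
    rw [if_neg (Finset.insert_ne_empty i s)]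
    refine h3.congr fun j => ?_
    rw [Finset.piecewise_insert, Finset.update_piecewise_of_notMem _ _ _ hi, sub_eq_iff_eq_add]
    have := M.map_update_add (s.piecewise (y j) (z j)) i (y j i) (z j i)
    rw [Finset.update_piecewise_of_notMem _ _ _ hi, Finset.update_piecewise_of_notMem _ _ _ hi,
      Finset.update_piecewise_of_notMem _ _ _ hi, Function.update_eq_self, add_comm (y j i)] at this
    exact this

variable [ContinuousSMul ℝ E]

/-- Telescoping: the coordinates are moved from `a` to `a + t • b` one at a time, each contributing
one summand. -/
theorem hasHadamardDeriv (M : MultilinearMap ℝ (fun _ : Fin m => E) V)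
    (hM : Continuous M) (a b : Fin m → E) :
    HasHadamardDeriv M a b (∑ i, M (Function.update a i (b i))) := by
  have key : ∀ s : Finset (Fin m), Tendsto (fun p : ℝ × (Fin m → E) =>
      p.1⁻¹ • (M (s.piecewise (a + p.1 • p.2) a) - M a)) (𝓝[≠] 0 ×ˢ 𝓝 b)
      (𝓝 (∑ i ∈ s, M (Function.update a i (b i)))) := by
    intro s
    induction s using Finset.induction_on with
    | empty => simp [tendsto_const_nhds]
    | insert i s hi ih =>
      have hp : Tendsto (fun p : ℝ × (Fin m → E) => s.piecewise (a + p.1 • p.2) a)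
          (𝓝[≠] 0 ×ˢ 𝓝 b) (𝓝 a) := by
        refine tendsto_pi_nhds.2 fun j => ?_
        by_cases hj : j ∈ s
        · simpa [hj] using (tendsto_pi_nhds.1 (tendsto_add_smul a b)) j
        · simp [hj, tendsto_const_nhds]
      have hb : Tendsto (fun p : ℝ × (Fin m → E) => p.2 i) (𝓝[≠] 0 ×ˢ 𝓝 b) (𝓝 (b i)) :=
        ((continuous_apply i).tendsto b).comp tendsto_snd
      rw [Finset.sum_insert hi]
      refine (((hM.tendsto _).comp (hp.update i hb)).add ih).congr' ?_
      filter_upwards [eventually_fst_ne_zero (𝓝 b)] with p hp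
      rw [Finset.piecewise_insert, Pi.add_apply, M.map_update_add,
        Finset.update_piecewise_of_notMem _ _ _ hi, Function.update_eq_self, Pi.smul_apply,
        M.map_update_smul, add_sub_right_comm, smul_add, smul_smul, inv_mul_cancel₀ hp, one_smul,
        add_comm]
      rfl
  simpa [HasHadamardDeriv] using key Finset.univ


/-- A multilinear map which is continuous at some point is continuous. -/
theorem continuous_of_continuousAt (M : MultilinearMap ℝ (fun _ : Fin m => E) V)
    {a : Fin m → E} (ha : ContinuousAt M a) : Continuous M := by
  rw [continuous_iff_continuousAt]
  intro b
  have hzero : ∀ i : Fin m, Tendsto (fun p : E × (Fin m → E) => M (Function.update p.2 i p.1))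
      (𝓝 0 ×ˢ 𝓝 b) (𝓝 0) := by
    intro i
    have hM0 : Tendsto M (𝓝 0) (𝓝 0) := by
      have := M.tendsto_piecewise_of_continuousAt ha (l := 𝓝 0) Finset.univ
        (y := fun y => y) (z := fun _ => a) tendsto_id tendsto_const_nhds
      rw [if_neg (Finset.univ_nonempty_iff.2 ⟨i⟩).ne_empty] at this
      simpa using this
    have hsc : Tendsto (fun p : ℝ × E × (Fin m → E) => Function.update (p.1 • p.2.2) i p.2.1)
        (𝓝[≠] 0 ×ˢ (𝓝 0 ×ˢ 𝓝 b)) (𝓝 0) := by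
      have : Tendsto (fun p : ℝ × E × (Fin m → E) => Function.update (p.1 • p.2.2) i p.2.1)
          (𝓝 0 ×ˢ (𝓝 0 ×ˢ 𝓝 b)) (𝓝 (Function.update ((0 : ℝ) • b) i 0)) := by
        rw [← nhds_prod_eq, ← nhds_prod_eq]
        exact Continuous.tendsto (f := fun p : ℝ × E × (Fin m → E) =>
          Function.update (p.1 • p.2.2) i p.2.1) (by fun_prop) (0, 0, b)
      rw [zero_smul, show Function.update (0 : Fin m → E) i 0 = 0 from
        Function.update_eq_self i 0] at this
      exact this.mono_left (prod_mono nhdsWithin_le_nhds le_rfl)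
    intro W hW
    have hev := ((hM0.comp hsc).eventually hW).curry
    obtain ⟨r, hr, hr0⟩ := (hev.and self_mem_nhdsWithin).exists
    have hr0 : r ≠ 0 := hr0
    -- Continuity at `0` only controls small arguments, so the slots other than `i` are scaled by a
    -- fixed small `r ≠ 0`. Dividing the small entry in slot `i` by `∏ j, c j` compensates for the
    -- scaling.
    set c : Fin m → ℝ := Function.update (fun _ => r) i 1 with hc
    have hP : (∏ j, c j) ≠ 0 := Finset.prod_ne_zero_iff.2 fun j _ => by
      rcases eq_or_ne j i with rfl | hj
      · simp [hc]
      · simpa [hc, hj] using hr0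
    have ht : Tendsto (fun p : E × (Fin m → E) => ((∏ j, c j)⁻¹ • p.1, p.2)) (𝓝 0 ×ˢ 𝓝 b)
        (𝓝 0 ×ˢ 𝓝 b) := by
      refine Tendsto.prodMap (f := fun x : E => (∏ j, c j)⁻¹ • x) (g := id) ?_ tendsto_id
      have : Tendsto (fun x : E => (∏ j, c j)⁻¹ • x) (𝓝 0) (𝓝 ((∏ j, c j)⁻¹ • (0 : E))) :=
        Continuous.tendsto (by fun_prop) _
      rwa [smul_zero] at this
    rw [mem_map]
    filter_upwards [show _ ∈ 𝓝 0 ×ˢ 𝓝 b from ht.eventually hr] with p hp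
    have h1 : M (Function.update (r • p.2) i ((∏ j, c j)⁻¹ • p.1)) ∈ W := hp
    have h2 : Function.update (r • p.2) i ((∏ j, c j)⁻¹ • p.1) =
        fun j => c j • Function.update p.2 i ((∏ j, c j)⁻¹ • p.1) j := by
      ext j
      rcases eq_or_ne j i with rfl | hj
      · simp [hc]
      · simp [hc, hj]
    rw [h2, M.map_smul_univ, M.map_update_smul, smul_smul, mul_inv_cancel₀ hP, one_smul] at h1
    exact h1
  -- Replace the coordinates of `b` by those of `z` one by one; each error has the small entry `z i
  -- - b i` and vanishes by `hzero`.
  have hpw : ∀ s : Finset (Fin m), Tendsto (fun z => M (s.piecewise z b)) (𝓝 b) (𝓝 (M b)) := by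
    intro s
    induction s using Finset.induction_on with
    | empty => simp [tendsto_const_nhds]
    | insert i s hi ih =>
      have hp : Tendsto (fun z : Fin m → E => s.piecewise z b) (𝓝 b) (𝓝 b) := by
        refine tendsto_pi_nhds.2 fun j => ?_
        by_cases hj : j ∈ s
        · simpa [hj] using (continuous_apply j).tendsto b
        · simp [hj, tendsto_const_nhds]
      have hi' : Tendsto (fun z : Fin m → E => z i - b i) (𝓝 b) (𝓝 0) := by
        have := ((continuous_apply i).tendsto b).sub_const (b i)
        rwa [sub_self] at this
      have h1 := ih.add ((hzero i).comp (hi'.prodMk hp))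
      rw [add_zero] at h1
      refine h1.congr fun z => ?_
      rw [Finset.piecewise_insert]
      have := M.map_update_add (s.piecewise z b) i (b i) (z i - b i)
      rw [add_sub_cancel] at this
      rw [this, Finset.update_piecewise_of_notMem _ _ _ hi, Function.update_eq_self]
      rfl
  simpa [ContinuousAt] using hpw Finset.univ

end MultilinearMap

/-! ### Pointwise limits of continuous maps on Baire spaces -/

/-- A pointwise limit of a sequence of continuous maps on a Baire space is the continuous limit
at some point. -/
theorem exists_tendsto_of_pointwise_limit {X V : Type*} [TopologicalSpace X] [BaireSpace X]
    [Nonempty X] [TopologicalSpace V] [TopologicalSpace.MetrizableSpace V] {F : ℕ → X → V}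
    {f : X → V} (hF : ∀ n, Continuous (F n)) (hf : ∀ x, Tendsto (fun n => F n x) atTop (𝓝 (f x))) :
    ∃ x, Tendsto (fun p : ℕ × X => F p.1 p.2) (atTop ×ˢ 𝓝 x) (𝓝 (f x)) := by
  let _ := TopologicalSpace.metrizableSpaceMetric V
  -- For each `k` these closed sets cover `X`, so their interiors have dense union. At a point
  -- common to these unions for all `k`, the sequence is uniformly close to one continuous `F N` on
  -- a neighborhood, for every accuracy.
  let A : ℕ → ℕ → Set X := fun k N =>
    {x | ∀ n, N ≤ n → dist (F n x) (F N x) ≤ 1 / (k + 1 : ℝ)}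
  have hA : ∀ k N, IsClosed (A k N) := fun k N => by
    simp only [A, ofPred_forall]
    exact isClosed_iInter fun n => isClosed_iInter fun _ =>
      isClosed_le ((hF n).dist (hF N)) continuous_const
  have hU : ∀ k, (⋃ N, A k N) = univ := fun k => by
    refine eq_univ_of_forall fun x => mem_iUnion.2 ?_
    obtain ⟨N, hN⟩ := Metric.cauchySeq_iff'.1 (hf x).cauchySeq (1 / (k + 1 : ℝ)) (by positivity)
    exact ⟨N, fun n hn => (hN n hn).le⟩
  have hd : Dense (⋂ k, ⋃ N, interior (A k N)) :=
    dense_iInter_of_isOpen (fun k => isOpen_iUnion fun N => isOpen_interior)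
      fun k => dense_iUnion_interior_of_closed (hA k) (hU k)
  obtain ⟨x, hx⟩ := hd.nonempty
  refine ⟨x, Metric.tendsto_nhds.2 fun ε hε => ?_⟩
  obtain ⟨k, hk⟩ := exists_nat_one_div_lt (show 0 < ε / 4 by positivity)
  obtain ⟨N, hN⟩ := mem_iUnion.1 (mem_iInter.1 hx k)
  have h0 : dist (F N x) (f x) ≤ 1 / (k + 1 : ℝ) := by
    rw [dist_comm]
    exact le_of_tendsto ((hf x).dist tendsto_const_nhds)
      (eventually_atTop.2 ⟨N, fun n hn => interior_subset hN n hn⟩)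
  have h1 : ∀ᶠ y in 𝓝 x, y ∈ A k N ∧ dist (F N y) (F N x) < ε / 4 :=
    (show ∀ᶠ y in 𝓝 x, y ∈ A k N from mem_interior_iff_mem_nhds.1 hN).and
      ((Metric.tendsto_nhds.1 ((hF N).tendsto x)) _ (by positivity))
  filter_upwards [tendsto_fst.eventually (eventually_ge_atTop N), tendsto_snd.eventually h1]
    with p hp1 hp2
  have e1 := hp2.1 p.1 hp1
  have e2 := hp2.2
  have t1 := dist_triangle (F p.1 p.2) (F N p.2) (f x)
  have t2 := dist_triangle (F N p.2) (F N x) (f x)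
  linarith

/-! ### Comparison with the definition by iterated directional derivatives -/

section Comparison

universe u v

variable {X : Type u} {Y : Type v}
  [AddCommGroup X] [Module ℝ X] [TopologicalSpace X]
  [AddCommGroup Y] [Module ℝ Y] [TopologicalSpace Y]

/-- The `j`-th iterated directional derivative of `f` at `x` in the directions `h`. -/
noncomputable def iterDirDeriv : (j : ℕ) → ∀ {X : Type u} [AddCommGroup X] [Module ℝ X],
    (X → Y) → X → (Fin j → X) → Y
  | 0, _, _, _, f, x, _ => f x
  | j + 1, _, _, _, f, x, h =>
      iterDirDeriv j (hadamardDeriv f) (x, h 0) (fun i => (h i.succ, 0))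

/-- The first direction is absorbed into the point `(x, h 0)`; the later directions `(h, 0)` leave
it fixed, so they differentiate only in the base point. -/
theorem HadamardCk.hasDirDeriv_iterDirDeriv : ∀ (j : ℕ) {X : Type u} [AddCommGroup X] [Module ℝ X]
    [TopologicalSpace X] {f : X → Y} {U : Set X}, HadamardCk (j + 1) f U → ∀ {x : X}, x ∈ U →
    ∀ h : Fin (j + 1) → X, HasDirDeriv (fun y => iterDirDeriv j f y (Fin.init h)) x
      (h (Fin.last j)) (iterDirDeriv (j + 1) f x h)
  | 0, _, _, _, _, _, _, hf, _, hx, h => (hf.hasHadamardDeriv hx (h 0)).hasDirDeriv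
  | j + 1, _, _, _, _, _, _, hf, x, hx, h => by
      have := hasDirDeriv_iterDirDeriv j hf.deriv (x := (x, h 0)) ⟨hx, trivial⟩
        (fun i => (h i.succ, 0))
      simp only [HasDirDeriv, Prod.smul_mk, Prod.mk_add_mk, smul_zero, add_zero] at this
      exact this

theorem HadamardCk.continuousOn_iterDirDeriv : ∀ (j : ℕ) {X : Type u} [AddCommGroup X]
    [Module ℝ X] [TopologicalSpace X] {f : X → Y} {U : Set X}, HadamardCk j f U →
    ContinuousOn (fun p : X × (Fin j → X) => iterDirDeriv j f p.1 p.2) (U ×ˢ univ)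
  | 0, _, _, _, _, _, _, hf => ContinuousOn.comp hf continuousOn_fst fun _ hp => hp.1
  | j + 1, X, _, _, _, _, _, hf => by
      refine (continuousOn_iterDirDeriv j hf.deriv).comp (f := fun p : X × (Fin (j + 1) → X) =>
        ((p.1, p.2 0), fun i : Fin j => (p.2 i.succ, (0 : X)))) (by fun_prop) ?_
      exact fun p hp => ⟨⟨hp.1, trivial⟩, trivial⟩

theorem isCkOn_of_hadamardCk {k : ℕ∞} {f : X → Y} {U : Set X}
    (hf : ∀ j : ℕ, (j : ℕ∞) ≤ k → HadamardCk j f U) : IsCkOn k f U :=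
  ⟨fun j => iterDirDeriv j f, fun _ _ _ => rfl,
    fun j hj _ hx h => (hf (j + 1) (by
      rw [Nat.cast_add, Nat.cast_one]; exact Order.add_one_le_of_lt hj)).hasDirDeriv_iterDirDeriv
        j hx h,
    fun j hj => (hf j hj).continuousOn_iterDirDeriv⟩

/-- `Fin.snoc` as a continuous linear map. -/
def snocCLM (X : Type*) [AddCommGroup X] [Module ℝ X] [TopologicalSpace X] (j : ℕ) :
    (Fin j → X) × X →L[ℝ] (Fin (j + 1) → X) where
  toFun p := Fin.snoc (α := fun _ => X) p.1 p.2
  map_add' p q := by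
    ext i; refine Fin.lastCases ?_ (fun i => ?_) i <;> simp
  map_smul' c p := by
    ext i; refine Fin.lastCases ?_ (fun i => ?_) i <;> simp
  cont := Continuous.finSnoc continuous_fst continuous_snd

/-- Updating a coordinate as a continuous linear map. -/
def updateCLM (X : Type*) [AddCommGroup X] [Module ℝ X] [TopologicalSpace X] {j : ℕ} (i : Fin j) :
    (Fin j → X) × X →L[ℝ] (Fin j → X) where
  toFun p := Function.update p.1 i p.2
  map_add' p q := by
    ext l; rcases eq_or_ne l i with rfl | hl <;> simp [*]
  map_smul' c p := by
    ext l; rcases eq_or_ne l i with rfl | hl <;> simp [*]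
  cont := continuous_fst.update i continuous_snd

@[simp] theorem snocCLM_apply {j : ℕ} (p : (Fin j → X) × X) :
    snocCLM X j p = Fin.snoc (α := fun _ => X) p.1 p.2 := rfl

variable [IsTopologicalAddGroup X] [ContinuousSMul ℝ X]
  [IsTopologicalAddGroup Y] [ContinuousSMul ℝ Y] [T2Space Y]

omit [IsTopologicalAddGroup X] [ContinuousSMul ℝ X] [IsTopologicalAddGroup Y] in
theorem HadamardCk.hadamardDeriv_smul {f : X → Y} {U : Set X} (hf : HadamardCk 1 f U) {x : X}
    (hx : x ∈ U) (a : ℝ) (h : X) :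
    hadamardDeriv f (x, a • h) = a • hadamardDeriv f (x, h) := by
  rcases eq_or_ne a 0 with rfl | ha
  · refine tendsto_nhds_unique (hf.hasHadamardDeriv hx _).tendsto ?_
    simp
  · exact tendsto_nhds_unique (hf.hasHadamardDeriv hx _).tendsto
      ((hf.hasHadamardDeriv hx h).smul_dir ha)

variable [LocallyConvexSpace ℝ Y]

/-! ### Multilinearity and joint differentiability of the iterated directional derivatives. -/

section

variable {k : ℕ∞} {U : Set X} {D : (j : ℕ) → X → (Fin j → X) → Y}
  (hU : IsOpen U)
  (hD : ∀ j : ℕ, (j : ℕ∞) < k → ∀ x ∈ U, ∀ h : Fin (j + 1) → X,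
      HasDirDeriv (fun y => D j y (Fin.init h)) x (h (Fin.last j)) (D (j + 1) x h))
  (hc : ∀ j : ℕ, (j : ℕ∞) ≤ k →
      ContinuousOn (fun p : X × (Fin j → X) => D j p.1 p.2) (U ×ˢ univ))

include hU hD hc

theorem hadamardCk_one_of_hasDirDeriv {j : ℕ} (hj : (j : ℕ∞) < k) (h : Fin j → X) :
    (∀ x ∈ U, ∀ v, HasHadamardDeriv (fun y => D j y h) x v (D (j + 1) x (Fin.snoc h v))) ∧
    HadamardCk 1 (fun y => D j y h) U := by
  have hcont : ContinuousOn (fun p : X × X => D (j + 1) p.1 (Fin.snoc h p.2)) (U ×ˢ univ) := by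
    refine (hc (j + 1) (by
      rw [Nat.cast_add, Nat.cast_one]; exact Order.add_one_le_of_lt hj)).comp
      (f := fun p : X × X => (p.1, (Fin.snoc (α := fun _ => X) h p.2 : Fin (j + 1) → X)))
      (Continuous.continuousOn ?_) fun p hp => ⟨hp.1, trivial⟩
    exact continuous_fst.prodMk (continuous_const.finSnoc continuous_snd)
  have key : ∀ x ∈ U, ∀ v,
      HasHadamardDeriv (fun y => D j y h) x v (D (j + 1) x (Fin.snoc h v)) := by
    intro x hx v
    refine hasHadamardDeriv_of_hasDirDeriv (f := fun _ y => D j y h)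
      (f' := fun _ p => D (j + 1) p.1 (Fin.snoc h p.2)) hU
      (.of_forall fun _ x hx v => ?_) hx (h := v) tendsto_fst tendsto_const_nhds tendsto_snd
      (((hcont.continuousAt ((hU.prod isOpen_univ).mem_nhds ⟨hx, trivial⟩)).tendsto).comp
        tendsto_snd)
    simpa using hD j hj x hx (Fin.snoc h v)
  refine ⟨key, HadamardCk.succ_of hU ?_ _ key hcont⟩
  exact (hc j hj.le).comp (f := fun x : X => (x, h)) (by fun_prop) fun x hx => ⟨hx, trivial⟩

/-- In the last slot this is linearity of the derivative of a `C^1`-map. In earlier slots the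
identities hold at order `j` near `x` and are differentiated in the last direction. -/
theorem map_update_of_hasDirDeriv (j : ℕ) (hj : (j : ℕ∞) ≤ k) :
    ∀ x ∈ U, ∀ (h : Fin j → X) (i : Fin j),
      (∀ y z, D j x (Function.update h i (y + z)) =
        D j x (Function.update h i y) + D j x (Function.update h i z)) ∧
      ∀ (c : ℝ) y, D j x (Function.update h i (c • y)) = c • D j x (Function.update h i y) := by
  induction j with
  | zero => intro x hx h i; exact i.elim0
  | succ j ih =>
    have hj' : (j : ℕ∞) < k := by
      rw [Nat.cast_add, Nat.cast_one] at hj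
      exact lt_of_lt_of_le (ENat.lt_add_one_iff (ENat.natCast_ne_top j) |>.2 le_rfl) hj
    intro x hx h i
    obtain ⟨h0, v, rfl⟩ : ∃ (h0 : Fin j → X) (v : X), h = Fin.snoc (α := fun _ => X) h0 v :=
      ⟨Fin.init h, h (Fin.last j), by simp⟩
    induction i using Fin.lastCases with
    | last =>
      obtain ⟨h1, h2⟩ := hadamardCk_one_of_hasDirDeriv hU hD hc hj' h0
      have he : ∀ y, D (j + 1) x (Fin.snoc h0 y) = hadamardDeriv (fun y => D j y h0) (x, y) :=
        fun y => ((h1 x hx y).hadamardDeriv_eq).symm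
      simp only [Fin.update_snoc_last, he]
      exact ⟨h2.hadamardDeriv_add hU hx, fun c y => h2.hadamardDeriv_smul hx c y⟩
    | cast i =>
      have h1 : ∀ h, HasHadamardDeriv (fun y => D j y h) x v (D (j + 1) x (Fin.snoc h v)) :=
        fun h => (hadamardCk_one_of_hasDirDeriv hU hD hc hj' h).1 x hx v
      simp only [← Fin.snoc_update]
      refine ⟨fun y z => ?_, fun c y => ?_⟩
      · refine HasHadamardDeriv.unique (h1 _) (((h1 (Function.update h0 i y)).add
          (h1 (Function.update h0 i z))).congr ?_)
        filter_upwards [hU.mem_nhds hx] with x' hx'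
        exact ((ih hj'.le x' hx' h0 i).1 y z).symm
      · refine HasHadamardDeriv.unique (h1 _) (((ContinuousLinearMap.hasHadamardDeriv
          (c • ContinuousLinearMap.id ℝ Y) _ _).comp (h1 (Function.update h0 i y))).congr ?_)
        filter_upwards [hU.mem_nhds hx] with x' hx'
        exact ((ih hj'.le x' hx' h0 i).2 c y).symm

/-- Move the base point first, with the moving directions as parameters of the mean value theorem,
then move the directions by multilinearity at fixed `x`. -/
theorem hasHadamardDeriv_uncurry {j : ℕ} (hj : (j : ℕ∞) < k) {x : X} (hx : x ∈ U)
    (h : Fin j → X) (v : X × (Fin j → X)) :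
    HasHadamardDeriv (fun p : X × (Fin j → X) => D j p.1 p.2) (x, h) v
      (D (j + 1) x (Fin.snoc h v.1) + ∑ i, D j x (Function.update h i (v.2 i))) := by
  let M : MultilinearMap ℝ (fun _ : Fin j => X) Y :=
    { toFun := D j x
      map_update_add' := fun {inst} h i y z => by
        rw [Subsingleton.elim inst (instDecidableEqFin j)]
        exact (map_update_of_hasDirDeriv hU hD hc j hj.le x hx h i).1 y z
      map_update_smul' := fun {inst} h i c y => by
        rw [Subsingleton.elim inst (instDecidableEqFin j)]
        exact (map_update_of_hasDirDeriv hU hD hc j hj.le x hx h i).2 c y }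
  have hM : Continuous M := by
    rw [← continuousOn_univ]
    exact (hc j hj.le).comp (f := fun h : Fin j → X => (x, h)) (by fun_prop)
      fun h _ => ⟨hx, trivial⟩
  have h2 : Tendsto (fun p : ℝ × X × (Fin j → X) => p.1⁻¹ • (D j x (h + p.1 • p.2.2) - D j x h))
      (𝓝[≠] 0 ×ˢ 𝓝 v) (𝓝 (∑ i, D j x (Function.update h i (v.2 i)))) :=
    Tendsto.comp (M.hasHadamardDeriv hM h v.2)
      (tendsto_fst.prodMk ((continuous_snd.tendsto v).comp tendsto_snd))
  have hj1 : ((j + 1 : ℕ) : ℕ∞) ≤ k := by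
    rw [Nat.cast_add, Nat.cast_one]; exact Order.add_one_le_of_lt hj
  have hb := (tendsto_add_smul (x, h) v)
  have h1 := hasHadamardDeriv_of_hasDirDeriv (l := 𝓝[≠] (0 : ℝ) ×ˢ 𝓝 v)
    (f := fun a y => D j y (h + a.1 • a.2.2))
    (f' := fun a p => D (j + 1) p.1 (Fin.snoc (h + a.1 • a.2.2) p.2))
    (y := D (j + 1) x (Fin.snoc h v.1))
    (u := fun _ => x) (q := fun a => a.2.1) (t := fun a => a.1) (h := v.1) hU
    (.of_forall fun a x hx w => by simpa using hD j hj x hx (Fin.snoc (h + a.1 • a.2.2) w)) hx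
    tendsto_fst tendsto_const_nhds ((continuous_fst.tendsto v).comp tendsto_snd) (by
      have hca := ((hc (j + 1) hj1).continuousAt ((hU.prod isOpen_univ).mem_nhds
        (show (x, (Fin.snoc (α := fun _ => X) h v.1 : Fin (j + 1) → X)) ∈ U ×ˢ univ from
          ⟨hx, trivial⟩))).tendsto
      refine hca.comp (f := fun p : (ℝ × X × (Fin j → X)) × X × X =>
        (p.2.1, (Fin.snoc (α := fun _ => X) (h + p.1.1 • p.1.2.2) p.2.2 : Fin (j + 1) → X))) ?_
      refine Tendsto.prodMk_nhds ((continuous_fst.tendsto (x, v.1)).comp tendsto_snd) ?_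
      exact (((snocCLM X j).continuous.tendsto (h, v.1))).comp
        (((continuous_snd.tendsto _).comp (hb.comp tendsto_fst)).prodMk_nhds
          ((continuous_snd.tendsto (x, v.1)).comp tendsto_snd)))
  refine (h1.add h2).congr fun p => ?_
  rw [← smul_add]
  congr 1
  exact sub_add_sub_cancel _ _ _

/-- The derivative of order `j` involves orders `j + 1` and `j` composed with linear maps, so the
induction on `n` treats all `j` with `j + n ≤ k` at once. -/
theorem hadamardCk_uncurry (n : ℕ) : ∀ j : ℕ, ((j + n : ℕ) : ℕ∞) ≤ k →
    HadamardCk n (fun p : X × (Fin j → X) => D j p.1 p.2) (U ×ˢ univ) := by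
  induction n with
  | zero => intro j hj; exact hc j (by simpa using hj)
  | succ n ih =>
    intro j hj
    have hj0 : (j : ℕ∞) < k := lt_of_lt_of_le (by norm_cast; omega) hj
    have hUU : IsOpen (U ×ˢ (univ : Set (Fin j → X))) := hU.prod isOpen_univ
    refine HadamardCk.succ_of hUU (hc j hj0.le)
      (fun p => D (j + 1) p.1.1 (Fin.snoc p.1.2 p.2.1) +
        ∑ i, D j p.1.1 (Function.update p.1.2 i (p.2.2 i)))
      (fun p hp v => hasHadamardDeriv_uncurry hU hD hc hj0 hp.1 p.2 v) ?_
    have hUU' := hUU.prod (isOpen_univ (X := X × (Fin j → X)))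
    let P := X × (Fin j → X)
    let a : P × P →L[ℝ] P := ContinuousLinearMap.fst ℝ P P
    let b : P × P →L[ℝ] P := ContinuousLinearMap.snd ℝ P P
    let p1 : P →L[ℝ] X := ContinuousLinearMap.fst ℝ X (Fin j → X)
    let p2 : P →L[ℝ] (Fin j → X) := ContinuousLinearMap.snd ℝ X (Fin j → X)
    refine HadamardCk.add hUU' ?_ (HadamardCk.sum _ hUU' fun i _ => ?_)
    · exact HadamardCk.comp_clm hUU' (ih (j + 1) (by convert hj using 2; omega))
        ((p1.comp a).prod ((snocCLM X j).comp ((p2.comp a).prod (p1.comp b))))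
        fun p hp => ⟨hp.1.1, trivial⟩
    · exact HadamardCk.comp_clm hUU' (ih j (le_trans (by norm_cast; omega) hj))
        ((p1.comp a).prod ((updateCLM X i).comp ((p2.comp a).prod
          ((ContinuousLinearMap.proj i).comp (p2.comp b)))))
        fun p hp => ⟨hp.1.1, trivial⟩

end

theorem isCkOn_iff_hadamardCk {k : ℕ∞} {f : X → Y} {U : Set X} (hU : IsOpen U) :
    IsCkOn k f U ↔ ∀ j : ℕ, (j : ℕ∞) ≤ k → HadamardCk j f U := by
  refine ⟨fun ⟨D, h0, hD, hc⟩ j hj => ?_, isCkOn_of_hadamardCk⟩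
  have h1 := hadamardCk_uncurry hU hD hc j 0 (by simpa using hj)
  refine HadamardCk.congr hU (HadamardCk.comp_clm hU h1
    ((ContinuousLinearMap.id ℝ X).prod 0) fun x hx => ⟨hx, trivial⟩) ?_
  exact fun x hx => h0 x hx _

end Comparison

/-! ### Smooth maps into Lie groups -/

section SmoothInto

universe u v w

theorem IsLocallyConvexLieGroup.isTopologicalGroup (E G : Type*) [AddCommGroup E] [Module ℝ E]
    [TopologicalSpace E] [TopologicalSpace G] [ChartedSpace E G] [Group G]
    [IsLocallyConvexLieGroup E G] : IsTopologicalGroup G where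
  continuous_mul :=
    let _ := prodManifold E G
    continuousOn_univ.1 (IsLocallyConvexLieGroup.smooth_mul (E := E) (G := G)).1
  continuous_inv := continuousOn_univ.1 (IsLocallyConvexLieGroup.smooth_inv (E := E) (G := G)).1

variable {E G : Type*} [AddCommGroup E] [Module ℝ E] [TopologicalSpace E]
  [TopologicalSpace G] [ChartedSpace E G]

/-- `γ : X → G` is smooth on the open subset `U` of the locally convex space `X`. -/
def IsSmoothInto (E : Type*) {G : Type*} [AddCommGroup E] [Module ℝ E] [TopologicalSpace E]
    [TopologicalSpace G] [ChartedSpace E G]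
    {X : Type u} [AddCommGroup X] [Module ℝ X] [TopologicalSpace X] (γ : X → G) (U : Set X) :
    Prop :=
  ContinuousOn γ U ∧ ∀ e ∈ atlas E G, ∀ k, HadamardCk k (e ∘ γ) (U ∩ γ ⁻¹' e.source)

/-- `f` is `C^k` on the open subset `S` of the manifold `G`. -/
def IsHadamardCkFrom (E : Type*) {G : Type*} [AddCommGroup E] [Module ℝ E] [TopologicalSpace E]
    [TopologicalSpace G] [ChartedSpace E G]
    {Y : Type v} [AddCommGroup Y] [Module ℝ Y] [TopologicalSpace Y] (k : ℕ) (f : G → Y)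
    (S : Set G) : Prop :=
  ∀ e ∈ atlas E G, HadamardCk k (f ∘ e.symm) (e.target ∩ e.symm ⁻¹' S)

theorem IsSmoothInto.mono {X : Type u} [AddCommGroup X] [Module ℝ X]
    [TopologicalSpace X] {γ : X → G} {U U' : Set X} (hγ : IsSmoothInto E γ U) (h : U' ⊆ U) :
    IsSmoothInto E γ U' :=
  ⟨hγ.1.mono h, fun e he k => (hγ.2 e he k).mono (inter_subset_inter_left _ h)⟩

variable {X : Type u} [AddCommGroup X] [Module ℝ X] [TopologicalSpace X]
  [IsTopologicalAddGroup X] [ContinuousSMul ℝ X]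
  {X' : Type w} [AddCommGroup X'] [Module ℝ X'] [TopologicalSpace X']
  [IsTopologicalAddGroup X'] [ContinuousSMul ℝ X']
  {Y : Type v} [AddCommGroup Y] [Module ℝ Y] [TopologicalSpace Y] [T2Space Y]
  [T2Space E]

theorem IsHadamardCkFrom.comp [IsTopologicalAddGroup E] [ContinuousSMul ℝ E] {k : ℕ} {f : G → Y} {S : Set G} {γ : X → G} {U : Set X}
    (hU : IsOpen U) (hf : IsHadamardCkFrom E k f S) (hγ : IsSmoothInto E γ U)
    (h : MapsTo γ U S) : HadamardCk k (f ∘ γ) U := by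
  refine HadamardCk.of_local fun x hx => ?_
  set e := chartAt E (γ x)
  have hW : IsOpen (U ∩ γ ⁻¹' e.source) := hγ.1.isOpen_inter_preimage hU e.open_source
  refine ⟨_, hW, ⟨hx, mem_chart_source E (γ x)⟩, ?_⟩
  have h1 : HadamardCk k ((f ∘ e.symm) ∘ (e ∘ γ)) (U ∩ γ ⁻¹' e.source) := by
    refine HadamardCk.comp hW (hf e (chart_mem_atlas E _)) (hγ.2 e (chart_mem_atlas E _) k) ?_
    rintro x' ⟨hx'U, hx'e⟩
    refine ⟨e.map_source hx'e, ?_⟩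
    simpa [e.left_inv hx'e] using h hx'U
  refine (h1.congr hW ?_).mono inter_subset_left
  rintro x' ⟨-, hx'e⟩
  simp [e.left_inv hx'e]

omit [IsTopologicalAddGroup X] [ContinuousSMul ℝ X] in
theorem IsSmoothInto.comp_clm {γ : X → G} {U : Set X} {U' : Set X'} (hU' : IsOpen U')
    (hγ : IsSmoothInto E γ U) (L : X' →L[ℝ] X) (h : MapsTo L U' U) :
    IsSmoothInto E (fun x => γ (L x)) U' := by
  have hc : ContinuousOn (fun x => γ (L x)) U' := hγ.1.comp L.continuous.continuousOn h
  refine ⟨hc, fun e he k => ?_⟩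
  exact HadamardCk.comp_clm (hc.isOpen_inter_preimage hU' e.open_source) (hγ.2 e he k) L
    fun x hx => ⟨h hx.1, hx.2⟩

omit [T2Space E] in
theorem isCkMapOn_iff_isHadamardCkFrom [IsTopologicalAddGroup E] [ContinuousSMul ℝ E]
    [LocallyConvexSpace ℝ Y] [IsTopologicalAddGroup Y]
    [ContinuousSMul ℝ Y] {k : ℕ∞} {f : G → Y} {S : Set G} (hS : IsOpen S) :
    IsCkMapOn E Y k f S ↔
      ContinuousOn f S ∧ ∀ j : ℕ, (j : ℕ∞) ≤ k → IsHadamardCkFrom E j f S := by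
  have hop : ∀ e : OpenPartialHomeomorph G E, IsOpen (e.target ∩ e.symm ⁻¹' S) := fun e =>
    e.symm.isOpen_inter_preimage hS
  refine and_congr_right fun hc => ⟨fun h j hj e he => ?_, fun h e he e' he' => ?_⟩
  · have h1 := h e he (OpenPartialHomeomorph.refl Y) (by simp)
    rw [isCkOn_iff_hadamardCk (by simpa using hop e)] at h1
    simpa [Function.comp_def] using h1 j hj
  · rw [chartedSpaceSelf_atlas] at he'
    subst he'
    rw [isCkOn_iff_hadamardCk (by simpa using hop e)]
    intro j hj
    simpa [Function.comp_def] using h j hj e he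

variable [IsTopologicalAddGroup E] [ContinuousSMul ℝ E] [LocallyConvexSpace ℝ E]

theorem isSmoothInto_of_isCkMap {f : E → G} (hf : IsCkMap E E ⊤ f) : IsSmoothInto E f univ := by
  refine ⟨hf.1, fun e he k => ?_⟩
  have h := hf.2 (OpenPartialHomeomorph.refl E) (by simp) e he
  have hc : Continuous f := continuousOn_univ.1 hf.1
  rw [isCkOn_iff_hadamardCk] at h
  · simpa [Function.comp_def] using h k le_top
  · simpa using e.open_source.preimage hc

variable [Group G] [IsLocallyConvexLieGroup E G]

theorem isSmoothInto_chart_symm {e : OpenPartialHomeomorph G E} (he : e ∈ atlas E G) :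
    IsSmoothInto E e.symm e.target := by
  refine ⟨e.continuousOn_symm, fun e' he' k => ?_⟩
  have := IsLocallyConvexLieGroup.smooth_transition e he e' he'
  exact (isCkOn_iff_hadamardCk (e.symm.isOpen_inter_preimage e'.open_source)).1 this k le_top

theorem IsSmoothInto.inv {γ : X → G} {U : Set X} (hU : IsOpen U) (hγ : IsSmoothInto E γ U) :
    IsSmoothInto E (fun x => (γ x)⁻¹) U := by
  have := IsLocallyConvexLieGroup.isTopologicalGroup E G
  have hc : ContinuousOn (fun x => (γ x)⁻¹) U := hγ.1.inv
  refine ⟨hc, fun e he k => ?_⟩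
  have hf : IsHadamardCkFrom E k (fun g : G => e g⁻¹) ((fun g => g⁻¹) ⁻¹' e.source) := by
    intro e' he'
    have h := (IsLocallyConvexLieGroup.smooth_inv (E := E) (G := G)).2 e' he' e he
    rw [univ_inter] at h
    exact (isCkOn_iff_hadamardCk (e'.symm.isOpen_inter_preimage
      (e.open_source.preimage continuous_inv))).1 h k le_top
  exact hf.comp (γ := γ) (hc.isOpen_inter_preimage hU e.open_source) (hγ.mono inter_subset_left)
    fun x hx => hx.2

theorem IsSmoothInto.mul {γ₁ γ₂ : X → G} {U : Set X} (hU : IsOpen U) (h₁ : IsSmoothInto E γ₁ U)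
    (h₂ : IsSmoothInto E γ₂ U) : IsSmoothInto E (fun x => γ₁ x * γ₂ x) U := by
  have := IsLocallyConvexLieGroup.isTopologicalGroup E G
  have hc : ContinuousOn (fun x => γ₁ x * γ₂ x) U := h₁.1.mul h₂.1
  refine ⟨hc, fun e he k => HadamardCk.of_local fun x hx => ?_⟩
  set e₁ := chartAt E (γ₁ x)
  set e₂ := chartAt E (γ₂ x)
  set W := (U ∩ γ₁ ⁻¹' e₁.source) ∩ (U ∩ γ₂ ⁻¹' e₂.source) ∩
    (U ∩ (fun x => γ₁ x * γ₂ x) ⁻¹' e.source)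
  have hW : IsOpen W := ((h₁.1.isOpen_inter_preimage hU e₁.open_source).inter
    (h₂.1.isOpen_inter_preimage hU e₂.open_source)).inter
    (hc.isOpen_inter_preimage hU e.open_source)
  refine ⟨W, hW, ⟨⟨⟨hx.1, mem_chart_source E (γ₁ x)⟩, ⟨hx.1, mem_chart_source E (γ₂ x)⟩⟩, hx⟩, ?_⟩
  have hm : HadamardCk k (fun p : E × E => e (e₁.symm p.1 * e₂.symm p.2))
      ((e₁.prod e₂).target ∩ (e₁.prod e₂).symm ⁻¹' ((fun p : G × G => p.1 * p.2) ⁻¹' e.source)) := by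
    let _ := prodManifold E G
    have h := (IsLocallyConvexLieGroup.smooth_mul (E := E) (G := G)).2 (e₁.prod e₂)
      ⟨e₁, chart_mem_atlas E _, e₂, chart_mem_atlas E _, rfl⟩ e he
    rw [univ_inter] at h
    exact (isCkOn_iff_hadamardCk ((e₁.prod e₂).symm.isOpen_inter_preimage
      (e.open_source.preimage continuous_mul))).1 h k le_top
  have h1 := hm.comp hW (HadamardCk.prodMk hW
    ((h₁.2 e₁ (chart_mem_atlas E _) k).mono fun y hy => hy.1.1)
    ((h₂.2 e₂ (chart_mem_atlas E _) k).mono fun y hy => hy.1.2)) (by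
      rintro y ⟨⟨⟨-, hy1⟩, ⟨-, hy2⟩⟩, ⟨-, hy3⟩⟩
      refine ⟨⟨e₁.map_source hy1, e₂.map_source hy2⟩, ?_⟩
      simpa [e₁.left_inv hy1, e₂.left_inv hy2] using hy3)
  refine (h1.congr hW ?_).mono inter_subset_left
  rintro y ⟨⟨⟨-, hy1⟩, ⟨-, hy2⟩⟩, ⟨-, hy3⟩⟩
  simp [e₁.left_inv hy1, e₂.left_inv hy2]

/-- `lg` is a smooth local inverse on `S` of `exp` near `0`. -/
structure IsLocalLog (E : Type*) {G : Type*} [AddCommGroup E] [Module ℝ E] [TopologicalSpace E]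
    [TopologicalSpace G] [ChartedSpace E G] [Group G] (exp : E → G) (lg : G → E) (S : Set G) :
    Prop where
  isOpen : IsOpen S
  one_mem : 1 ∈ S
  smooth : ∀ k, IsHadamardCkFrom E k lg S
  lg_one : lg 1 = 0
  exp_lg : ∀ g ∈ S, exp (lg g) = g
  lg_exp : ∀ᶠ x in 𝓝 (0 : E), lg (exp x) = x

omit [IsTopologicalAddGroup E] [ContinuousSMul ℝ E] [T2Space E] [LocallyConvexSpace ℝ E]
  [IsLocallyConvexLieGroup E G] in
theorem IsExponentialFunction.map_zero {exp : E → G} (hexp : IsExponentialFunction E exp) :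
    exp 0 = 1 := by
  have := hexp.map_add 0 0 0
  simpa using this

omit [IsLocallyConvexLieGroup E G] in
theorem IsLocallyExponential.exists_isLocalLog {exp : E → G} (hexp : IsLocallyExponential E exp) :
    ∃ (lg : G → E) (S : Set G), IsLocalLog E exp lg S := by
  obtain ⟨φ, h0, heq, -, hs⟩ := hexp.local_diffeo
  have h1 : φ 0 = 1 := (heq h0).trans hexp.isExp.map_zero
  refine ⟨φ.symm, φ.target, φ.open_target, h1 ▸ φ.map_source h0, fun k => ?_, ?_, ?_, ?_⟩
  · exact ((isCkMapOn_iff_isHadamardCkFrom φ.open_target).1 hs).2 k le_top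
  · rw [← h1, φ.left_inv h0]
  · intro g hg
    rw [← heq (φ.map_target hg), φ.right_inv hg]
  · filter_upwards [φ.open_source.mem_nhds h0] with x hx
    rw [← heq hx, φ.left_inv hx]

/-- `δ` is the left logarithmic derivative, obtained by differentiating `(x, x') ↦ lg ((γ x)⁻¹ * γ
x')` in `x'` on the diagonal. Taking for `q` the difference quotient itself makes the factorization
exact. -/
theorem IsLocalLog.exists_logDeriv {exp : E → G} {lg : G → E} {S : Set G}
    (hlg : IsLocalLog E exp lg S) {γ : X → G} {U : Set X} (hU : IsOpen U)
    (hγ : IsSmoothInto E γ U) :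
    ∃ δ : X × X → E, (∀ k, HadamardCk k δ (U ×ˢ univ)) ∧ ∀ x ∈ U, ∀ h,
      ∃ q : ℝ × X → E, Tendsto q (𝓝[≠] 0 ×ˢ 𝓝 h) (𝓝 (δ (x, h))) ∧
        ∀ᶠ p in 𝓝[≠] 0 ×ˢ 𝓝 h, γ (x + p.1 • p.2) = γ x * exp (p.1 • q p) := by
  have hUU : IsOpen (U ×ˢ U) := hU.prod hU
  have hG : IsSmoothInto E (fun p : X × X => (γ p.1)⁻¹ * γ p.2) (U ×ˢ U) :=
    ((hγ.comp_clm hUU (ContinuousLinearMap.fst ℝ X X) fun p hp => hp.1).inv hUU).mul hUU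
      (hγ.comp_clm hUU (ContinuousLinearMap.snd ℝ X X) fun p hp => hp.2)
  set Ω := (U ×ˢ U) ∩ (fun p : X × X => (γ p.1)⁻¹ * γ p.2) ⁻¹' S
  have hΩ : IsOpen Ω := hG.1.isOpen_inter_preimage hUU hlg.isOpen
  set β : X × X → E := lg ∘ fun p : X × X => (γ p.1)⁻¹ * γ p.2
  have hβ : ∀ k, HadamardCk k β Ω := fun k =>
    (hlg.smooth k).comp hΩ (hG.mono inter_subset_left) fun p hp => hp.2
  have hdiag : ∀ x ∈ U, (x, x) ∈ Ω := fun x hx => ⟨⟨hx, hx⟩, by simpa using hlg.one_mem⟩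
  let I := ContinuousLinearMap.fst ℝ X X
  let J := ContinuousLinearMap.snd ℝ X X
  refine ⟨fun p => hadamardDeriv β ((p.1, p.1), (0, p.2)), fun k => ?_, fun x hx h => ?_⟩
  · exact HadamardCk.comp_clm (hU.prod isOpen_univ) (hβ (k + 1)).deriv
      ((I.prod I).prod ((0 : X × X →L[ℝ] X).prod J)) fun p hp => ⟨hdiag _ hp.1, trivial⟩
  · have hd := (hβ 1).hasHadamardDeriv (hdiag x hx) (0, h)
    have hlim : Tendsto (fun p : ℝ × X => (p.1, ((0 : X), p.2))) (𝓝[≠] 0 ×ˢ 𝓝 h)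
        (𝓝[≠] 0 ×ˢ 𝓝 (0, h)) :=
      tendsto_fst.prodMk (tendsto_const_nhds.prodMk_nhds tendsto_snd)
    refine ⟨_, Tendsto.comp hd hlim, ?_⟩
    have hmem := (tendsto_add_smul (x, x) ((0 : X), h)).comp hlim (hΩ.mem_nhds (hdiag x hx))
    filter_upwards [hmem, eventually_fst_ne_zero (𝓝 h)] with p hp hp0
    have hp : ((x, x) + p.1 • ((0 : X), p.2)) ∈ Ω := hp
    have h1 : β (x, x) = 0 := by simp [β, hlg.lg_one]
    have h2 := hlg.exp_lg _ hp.2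
    simp only [Prod.smul_mk, Prod.mk_add_mk, smul_zero, add_zero] at h2
    simp only [Function.comp_apply, smul_smul, mul_inv_cancel₀ hp0, one_smul, h1, sub_zero,
      Prod.smul_mk, Prod.mk_add_mk, smul_zero, add_zero]
    simp only [β, Function.comp_apply]
    rw [h2, mul_inv_cancel_left]

/-- The derivative at `0` of multiplication in exponential coordinates is addition; `w` is the
corresponding difference quotient. -/
theorem IsLocalLog.exists_exp_mul_exp {exp : E → G} {lg : G → E} {S : Set G}
    (hlg : IsLocalLog E exp lg S) (hexp : IsExponentialFunction E exp) {α : Type*} {l : Filter α}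
    {t : α → ℝ} {a b : α → E} {x y : E} (ht : Tendsto t l (𝓝[≠] 0)) (ha : Tendsto a l (𝓝 x))
    (hb : Tendsto b l (𝓝 y)) :
    ∃ w : α → E, Tendsto w l (𝓝 (x + y)) ∧
      ∀ᶠ i in l, exp (t i • a i) * exp (t i • b i) = exp (t i • w i) := by
  have hs := isSmoothInto_of_isCkMap hexp.smooth
  have hG : IsSmoothInto E (fun p : E × E => exp p.1 * exp p.2) univ :=
    (hs.comp_clm isOpen_univ (ContinuousLinearMap.fst ℝ E E) (mapsTo_univ _ _)).mul isOpen_univ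
      (hs.comp_clm isOpen_univ (ContinuousLinearMap.snd ℝ E E) (mapsTo_univ _ _))
  set Ω := univ ∩ (fun p : E × E => exp p.1 * exp p.2) ⁻¹' S
  have hΩ : IsOpen Ω := hG.1.isOpen_inter_preimage isOpen_univ hlg.isOpen
  set μ : E × E → E := lg ∘ fun p : E × E => exp p.1 * exp p.2
  have hμ : HadamardCk 1 μ Ω :=
    (hlg.smooth 1).comp hΩ (hG.mono inter_subset_left) fun p hp => hp.2
  have h0 : (0 : E × E) ∈ Ω := ⟨trivial, by simpa [hexp.map_zero] using hlg.one_mem⟩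
  have hμ0 : μ 0 = 0 := by simp [μ, hexp.map_zero, hlg.lg_one]
  -- Used for `(x, 0)` and `(0, y)`, where the product is a one-parameter group; additivity of the
  -- derivative gives the general direction.
  have hline : ∀ v : E × E, ∀ z : E, (∀ r : ℝ, exp (r • v.1) * exp (r • v.2) = exp (r • z)) →
      hadamardDeriv μ (0, v) = z := by
    intro v z hv
    refine tendsto_nhds_unique (hμ.hasHadamardDeriv h0 v).tendsto
      (tendsto_const_nhds.congr' ?_)
    have hz : Tendsto (fun r : ℝ => r • z) (𝓝[≠] 0) (𝓝 0) := by
      have := (tendsto_add_smul (0 : E) z).comp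
        ((tendsto_id (x := 𝓝[≠] (0 : ℝ))).prodMk (tendsto_const_nhds (x := z)))
      simpa [Function.comp_def] using this
    filter_upwards [hz.eventually hlg.lg_exp, self_mem_nhdsWithin] with r hr hr0
    have hr0 : r ≠ 0 := hr0
    simp only [hμ0, zero_add, sub_zero]
    simp only [μ, Function.comp, Prod.smul_fst, Prod.smul_snd, hv, hr, smul_smul,
      inv_mul_cancel₀ hr0, one_smul]
  have hd : hadamardDeriv μ (0, (x, y)) = x + y := by
    have hxy : ((x, y) : E × E) = (x, 0) + (0, y) := by simp
    rw [hxy, hμ.hadamardDeriv_add hΩ h0, hline (x, 0) x (by simp [hexp.map_zero]),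
      hline (0, y) y (by simp [hexp.map_zero])]
  have hT := hμ.hasHadamardDeriv h0 (x, y)
  rw [hd] at hT
  have hlim := ht.prodMk (ha.prodMk_nhds hb)
  refine ⟨_, Tendsto.comp hT hlim, ?_⟩
  have hmem := (tendsto_add_smul (0 : E × E) (x, y)).comp hlim (hΩ.mem_nhds h0)
  filter_upwards [hmem, (tendsto_nhdsWithin_iff.1 ht).2] with i hi hi0
  have hi0 : t i ≠ 0 := hi0
  have h2 := hlg.exp_lg _ (show (0 : E × E) + t i • (a i, b i) ∈ Ω from hi).2
  simp only [Prod.smul_mk, zero_add] at h2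
  simp only [Function.comp_apply, smul_smul, mul_inv_cancel₀ hi0, one_smul, hμ0, sub_zero,
    Prod.smul_mk, zero_add]
  simp only [μ, Function.comp_apply]
  rw [h2]

end SmoothInto

/-! ### Generators and their common domains -/

section Generators

universe u

variable {E G V : Type*} [AddCommGroup E] [Module ℝ E] [Group G]
  [AddCommGroup V] [Module ℝ V] [TopologicalSpace V] [T2Space V]
  {π : Representation ℝ G V} {exp : E → G}

theorem tendsto_gen (h0 : exp 0 = 1) {x : E} {v : V} (hv : v ∈ genDomain π exp x) :
    Tendsto (fun t : ℝ => t⁻¹ • (π (exp (t • x)) v - v)) (𝓝[≠] 0) (𝓝 (gen π exp x v)) := by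
  obtain ⟨w, hw⟩ := hv
  have h : gen π exp x v = w := Tendsto.limUnder_eq hw
  rw [h]
  simpa [HasDerivAtZero, h0] using hw

theorem gen_eq_of_tendsto (h0 : exp 0 = 1) {x : E} {v w : V}
    (h : Tendsto (fun t : ℝ => t⁻¹ • (π (exp (t • x)) v - v)) (𝓝[≠] 0) (𝓝 w)) :
    v ∈ genDomain π exp x ∧ gen π exp x v = w := by
  have hw : HasDerivAtZero (fun t : ℝ => π (exp (t • x)) v) w := by
    simpa [HasDerivAtZero, h0] using h
  exact ⟨⟨w, hw⟩, Tendsto.limUnder_eq hw⟩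

omit [T2Space V] in
theorem mem_commonDomain_one {v : V} :
    v ∈ commonDomain π exp 1 ↔ ∀ x, v ∈ genDomain π exp x := by
  simp [commonDomain]

omit [T2Space V] in
-- A uniform recursion for inductions: with `𝒟^0 = V` the second condition is vacuous at `n = 0`.
theorem mem_commonDomain_succ {n : ℕ} {v : V} : v ∈ commonDomain π exp (n + 1) ↔
    v ∈ commonDomain π exp 1 ∧ ∀ x, gen π exp x v ∈ commonDomain π exp n := by
  cases n with
  | zero => simp [commonDomain]
  | succ n => rfl

omit [T2Space V] in
theorem commonDomain_succ_subset (n : ℕ) :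
    commonDomain π exp (n + 1) ⊆ commonDomain π exp n := by
  induction n with
  | zero => exact fun v _ => trivial
  | succ n ih =>
    intro v hv
    rw [mem_commonDomain_succ] at hv ⊢
    exact ⟨hv.1, fun x => ih (hv.2 x)⟩

theorem gen_add_right [ContinuousAdd V] (h0 : exp 0 = 1) {x : E} {v w : V}
    (hv : v ∈ genDomain π exp x) (hw : w ∈ genDomain π exp x) :
    gen π exp x (v + w) = gen π exp x v + gen π exp x w := by
  refine (gen_eq_of_tendsto h0 (((tendsto_gen h0 hv).add (tendsto_gen h0 hw)).congr
    fun t => ?_)).2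
  rw [← smul_add, map_add, add_sub_add_comm]

theorem gen_smul_right [ContinuousSMul ℝ V] (h0 : exp 0 = 1) {x : E} {v : V} (c : ℝ)
    (hv : v ∈ genDomain π exp x) : gen π exp x (c • v) = c • gen π exp x v := by
  refine (gen_eq_of_tendsto h0 (((tendsto_gen h0 hv).const_smul c).congr fun t => ?_)).2
  rw [map_smul, ← smul_sub, smul_comm]

theorem gen_smul_left [ContinuousSMul ℝ V] (h0 : exp 0 = 1) {x : E} {v : V} (c : ℝ)
    (hv : v ∈ genDomain π exp x) : gen π exp (c • x) v = c • gen π exp x v := by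
  refine (gen_eq_of_tendsto h0 ?_).2
  rcases eq_or_ne c 0 with rfl | hc
  · simp [h0]
  · have hm := tendsto_mul_const_nhdsNE_zero hc
    refine (((tendsto_gen h0 hv).comp hm).const_smul c).congr fun t => ?_
    simp only [Function.comp, smul_smul, mul_inv]
    congr 1
    field_simp

variable [TopologicalSpace E] [TopologicalSpace G]

omit [T2Space V] in
-- Write `π (g * g') v - v` as `(π g v - v) + π g (π g' v - v)` and use joint continuity of the
-- action at `(1, Q)`.
theorem tendsto_quotient_mul [ContinuousAdd V] (hπ : Continuous (fun p : G × V => π p.1 p.2))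
    {α : Type*} {l : Filter α} {t : α → ℝ} {g g' : α → G} {v P Q : V}
    (hg : Tendsto g l (𝓝 1)) (hP : Tendsto (fun i => (t i)⁻¹ • (π (g i) v - v)) l (𝓝 P))
    (hQ : Tendsto (fun i => (t i)⁻¹ • (π (g' i) v - v)) l (𝓝 Q)) :
    Tendsto (fun i => (t i)⁻¹ • (π (g i * g' i) v - v)) l (𝓝 (P + Q)) := by
  have h1 : Tendsto (fun i => π (g i) ((t i)⁻¹ • (π (g' i) v - v))) l (𝓝 Q) := by
    have := (hπ.tendsto (1, Q)).comp (hg.prodMk_nhds hQ)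
    simpa [Function.comp_def] using this
  refine (hP.add h1).congr fun i => ?_
  rw [map_smul, ← smul_add, map_sub, map_mul, add_comm, Module.End.mul_apply,
    sub_add_sub_cancel]

variable [IsTopologicalAddGroup E] [ContinuousSMul ℝ E] [LocallyConvexSpace ℝ E] [T2Space E]
  [BaireSpace E] [ChartedSpace E G] [IsLocallyConvexLieGroup E G]
  [IsTopologicalAddGroup V] [ContinuousSMul ℝ V] [TopologicalSpace.MetrizableSpace V]

omit [T2Space V] in
theorem gen_add_left {lg : G → E} {S : Set G}
    (hlg : IsLocalLog E exp lg S) (hexp : IsExponentialFunction E exp)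
    (hπ : Continuous (fun p : G × V => π p.1 p.2)) {v : V} (hv : ∀ x, v ∈ genDomain π exp x)
    (x y : E) : gen π exp (x + y) v = gen π exp x v + gen π exp y v := by
  have h0 := hexp.map_zero
  have hec : Continuous exp := continuousOn_univ.1 (isSmoothInto_of_isCkMap hexp.smooth).1
  let t : ℕ → ℝ := fun n => 1 / (n + 1 : ℝ)
  have ht : Tendsto t atTop (𝓝[≠] 0) := tendsto_one_div_add_atTop_nhdsNE_zero
  let F : ℕ → E → V := fun n z => (t n)⁻¹ • (π (exp (t n • z)) v - v)
  have hF : ∀ n, Continuous (F n) := fun n => by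
    have : Continuous fun z => π (exp (t n • z)) v :=
      hπ.comp ((hec.comp (continuous_const_smul (t n))).prodMk continuous_const)
    exact (this.sub continuous_const).const_smul _
  have hlim : ∀ z, Tendsto (fun n => F n z) atTop (𝓝 (gen π exp z v)) := fun z =>
    (tendsto_gen h0 (hv z)).comp ht
  have hone : ∀ {w : ℕ → E} {z : E}, Tendsto w atTop (𝓝 z) →
      Tendsto (fun n => exp (t n • w n)) atTop (𝓝 1) := fun {w z} hw => by
    have h1 := (tendsto_nhds_of_tendsto_nhdsWithin ht).smul hw
    rw [zero_smul] at h1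
    simpa [h0, Function.comp_def] using (hec.tendsto 0).comp h1
  obtain ⟨x₀, hx₀⟩ := exists_tendsto_of_pointwise_limit hF hlim
  -- Transport of continuous convergence from `x₀` to `z`: up to a factor `exp (t n • (z - x₀))` on
  -- the right, `exp (t n • w n)` is `exp (t n • a n)` with `a n → x₀`.
  have key : ∀ {z : E} {w : ℕ → E}, Tendsto w atTop (𝓝 z) →
      Tendsto (fun n => F n (w n)) atTop (𝓝 (gen π exp x₀ v + gen π exp (z - x₀) v)) := by
    intro z w hw
    obtain ⟨a, ha, hea⟩ := hlg.exists_exp_mul_exp hexp ht hw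
      (tendsto_const_nhds (x := x₀ - z))
    rw [add_sub_cancel] at ha
    have h1 : Tendsto (fun n => F n (a n)) atTop (𝓝 (gen π exp x₀ v)) :=
      
      Tendsto.comp (g := fun p : ℕ × E => F p.1 p.2) (f := fun n => (n, a n)) hx₀
        (tendsto_id.prodMk ha)
    refine (tendsto_quotient_mul hπ (hone ha) h1 (hlim (z - x₀))).congr' ?_
    filter_upwards [hea] with n hn
    have h2 : exp (t n • (x₀ - z)) * exp (t n • (z - x₀)) = 1 := by
      have := hexp.map_add (x₀ - z) (t n) (-t n)
      rw [add_neg_cancel, zero_smul, h0, neg_smul, ← smul_neg, neg_sub] at this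
      exact this.symm
    rw [← hn, mul_assoc, h2, mul_one]
  have hgen : ∀ {z : E} {w : ℕ → E}, Tendsto w atTop (𝓝 z) →
      Tendsto (fun n => F n (w n)) atTop (𝓝 (gen π exp z v)) := by
    intro z w hw
    -- The constant sequence `w = z` identifies the limit in `key` as `gen π exp z v`.
    rw [tendsto_nhds_unique (hlim z) (key (tendsto_const_nhds (x := z)))]
    exact key hw
  obtain ⟨w, hw, hew⟩ := hlg.exists_exp_mul_exp hexp ht (tendsto_const_nhds (x := x))
    (tendsto_const_nhds (x := y))
  refine tendsto_nhds_unique (hgen hw) ((tendsto_quotient_mul hπ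
    (hone (tendsto_const_nhds (x := x))) (hlim x) (hlim y)).congr' ?_)
  filter_upwards [hew] with n hn
  rw [hn]

omit [T2Space V] in
/-- The multilinear map `(h₀, …, h_m) ↦ dπ(h_m) M(h₀, …, h_{m-1})`. -/
theorem exists_multilinearMap_gen {lg : G → E} {S : Set G}
    (hlg : IsLocalLog E exp lg S) (hexp : IsExponentialFunction E exp)
    (hπ : Continuous (fun p : G × V => π p.1 p.2)) {m : ℕ} [BaireSpace (Fin (m + 1) → E)]
    (M : MultilinearMap ℝ (fun _ : Fin m => E) V) (hM : Continuous M)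
    (hMD : ∀ h, M h ∈ commonDomain π exp 1) :
    ∃ M' : MultilinearMap ℝ (fun _ : Fin (m + 1) => E) V, Continuous M' ∧
      ∀ h, M' h = gen π exp (h (Fin.last m)) (M (Fin.init h)) := by
  have h0 := hexp.map_zero
  have hec : Continuous exp := continuousOn_univ.1 (isSmoothInto_of_isCkMap hexp.smooth).1
  have hMD' : ∀ h x, M h ∈ genDomain π exp x := fun h => mem_commonDomain_one.1 (hMD h)
  have hlast : ∀ (h : Fin (m + 1) → E) (i : Fin m) y,
      Function.update h i.castSucc y (Fin.last m) = h (Fin.last m) := fun h i y =>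
    Function.update_of_ne (Fin.castSucc_lt_last i).ne' _ _
  let M' : MultilinearMap ℝ (fun _ : Fin (m + 1) => E) V :=
    { toFun := fun h => gen π exp (h (Fin.last m)) (M (Fin.init h))
      map_update_add' := fun {inst} h i y z => by
        rw [Subsingleton.elim inst (instDecidableEqFin (m + 1))]
        induction i using Fin.lastCases with
        | last =>
          simp only [Function.update_self, Fin.init_update_last]
          exact gen_add_left hlg hexp hπ (hMD' _) y z
        | cast i =>
          simp only [Fin.init_update_castSucc, M.map_update_add, hlast]
          exact gen_add_right h0 (hMD' _ _) (hMD' _ _)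
      map_update_smul' := fun {inst} h i c y => by
        rw [Subsingleton.elim inst (instDecidableEqFin (m + 1))]
        induction i using Fin.lastCases with
        | last =>
          simp only [Function.update_self, Fin.init_update_last]
          exact gen_smul_left h0 c (hMD' _ _)
        | cast i =>
          simp only [Fin.init_update_castSucc, M.map_update_smul, hlast]
          exact gen_smul_right h0 c (hMD' _ _) }
  refine ⟨M', ?_, fun _ => rfl⟩
  let t : ℕ → ℝ := fun n => 1 / (n + 1 : ℝ)
  have ht : Tendsto t atTop (𝓝[≠] 0) := tendsto_one_div_add_atTop_nhdsNE_zero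
  let F : ℕ → (Fin (m + 1) → E) → V := fun n h =>
    (t n)⁻¹ • (π (exp (t n • h (Fin.last m))) (M (Fin.init h)) - M (Fin.init h))
  have hinit : Continuous fun h : Fin (m + 1) → E => M (Fin.init h) :=
    hM.comp (continuous_pi fun i => continuous_apply i.castSucc)
  have hF : ∀ n, Continuous (F n) := fun n => by
    have : Continuous fun h : Fin (m + 1) → E =>
        π (exp (t n • h (Fin.last m))) (M (Fin.init h)) :=
      hπ.comp ((hec.comp ((continuous_apply _).const_smul (t n))).prodMk hinit)
    exact (this.sub hinit).const_smul _
  obtain ⟨a, ha⟩ := exists_tendsto_of_pointwise_limit hF (f := M')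
    fun h => (tendsto_gen h0 (hMD' (Fin.init h) (h (Fin.last m)))).comp ht
  refine M'.continuous_of_continuousAt (a := a) ?_
  -- Continuous convergence at `a` forces the limit `M'` to be continuous there: for `h` near `a`,
  -- closed neighborhoods retain the limits in `n`, and closed neighborhoods suffice since `V` is
  -- regular.
  have hcurry : ∀ W ∈ 𝓝 (M' a), IsClosed W → ∀ᶠ h in 𝓝 a, M' h ∈ W := by
    intro W hW hWc
    have h1 : ∀ᶠ p : (Fin (m + 1) → E) × ℕ in 𝓝 a ×ˢ atTop, F p.2 p.1 ∈ W :=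
      (ha.comp (tendsto_snd.prodMk tendsto_fst)) hW
    filter_upwards [h1.curry] with h hh
    exact hWc.mem_of_tendsto ((tendsto_gen h0 (hMD' (Fin.init h) (h (Fin.last m)))).comp ht) hh
  intro W hW
  obtain ⟨W', hW', hWc, hsub⟩ := exists_mem_nhds_isClosed_subset hW
  filter_upwards [hcurry W' hW' hWc] with h hh using hsub hh

end Generators

/-! ### Differentiable vectors -/

section Orbits

universe u

variable {E G V : Type*} [AddCommGroup E] [Module ℝ E] [TopologicalSpace E]
  [IsTopologicalAddGroup E] [ContinuousSMul ℝ E] [LocallyConvexSpace ℝ E] [T2Space E]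
  [TopologicalSpace G] [ChartedSpace E G] [Group G] [IsLocallyConvexLieGroup E G]
  [AddCommGroup V] [Module ℝ V] [TopologicalSpace V] [IsTopologicalAddGroup V]
  [ContinuousSMul ℝ V] [LocallyConvexSpace ℝ V] [T2Space V]
  {π : Representation ℝ G V} {exp : E → G}

omit [IsTopologicalAddGroup E] [ContinuousSMul ℝ E] [LocallyConvexSpace ℝ E] [T2Space E]
  [IsLocallyConvexLieGroup E G] [IsTopologicalAddGroup V] [ContinuousSMul ℝ V]
  [LocallyConvexSpace ℝ V] in
theorem hasCurveDeriv_exp (hexp : IsExponentialFunction E exp)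
    (hπ : Continuous (fun p : G × V => π p.1 p.2)) {v : V} {x : E}
    (hv : v ∈ genDomain π exp x) (s : ℝ) :
    HasCurveDeriv (fun s => π (exp (s • x)) v) s (π (exp (s • x)) (gen π exp x v)) := by
  have hg : Continuous (π (exp (s • x))) := hπ.comp (Continuous.prodMk_right (exp (s • x)))
  refine ((hg.tendsto _).comp (tendsto_gen hexp.map_zero hv)).congr fun t => ?_
  simp only [Function.comp_apply, map_smul, map_sub]
  rw [hexp.map_add, map_mul, Module.End.mul_apply]

omit [IsTopologicalAddGroup V] [ContinuousSMul ℝ V] [LocallyConvexSpace ℝ V] in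
-- In a chart `e`, the `t`-derivative at `0` of `π (e.symm y * exp (t • x)) v` is `C^k` in `y`, and
-- by continuity of `π (e.symm y)` it equals `π (e.symm y)` applied to the generator.
theorem IsHadamardCkFrom.gen (hexp : IsExponentialFunction E exp)
    (hπ : Continuous (fun p : G × V => π p.1 p.2)) {k : ℕ} {v : V}
    (hv : IsHadamardCkFrom E (k + 1) (fun g => π g v) univ) (x : E) :
    v ∈ genDomain π exp x ∧ IsHadamardCkFrom E k (fun g => π g (gen π exp x v)) univ := by
  have h0 := hexp.map_zero
  let L : E × ℝ →L[ℝ] E := (ContinuousLinearMap.snd ℝ E ℝ).smulRight x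
  have key : ∀ e ∈ atlas E G, ∃ ξ : E → V, HadamardCk k ξ e.target ∧ ∀ y ∈ e.target,
      Tendsto (fun t : ℝ => t⁻¹ • (π (e.symm y) (π (exp (t • x)) v - v))) (𝓝[≠] 0)
        (𝓝 (ξ y)) := by
    intro e he
    have hU : IsOpen (e.target ×ˢ (univ : Set ℝ)) := e.open_target.prod isOpen_univ
    have hγ : IsSmoothInto E (fun p : E × ℝ => e.symm p.1 * exp (L p)) (e.target ×ˢ univ) :=
      ((isSmoothInto_chart_symm he).comp_clm hU (ContinuousLinearMap.fst ℝ E ℝ)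
        fun p hp => hp.1).mul hU
        ((isSmoothInto_of_isCkMap hexp.smooth).comp_clm hU L (mapsTo_univ _ _))
    have hf := hv.comp hU hγ (mapsTo_univ _ _)
    refine ⟨fun y => hadamardDeriv ((fun g => π g v) ∘ fun p : E × ℝ => e.symm p.1 * exp (L p))
      ((y, 0), (0, 1)), ?_, fun y hy => ?_⟩
    · have hc : HadamardCk k (fun y : E => (((y, 0), (0, 1)) : (E × ℝ) × (E × ℝ))) e.target :=
        HadamardCk.prodMk e.open_target
          (HadamardCk.clm k (ContinuousLinearMap.inl ℝ E ℝ) e.open_target)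
          (HadamardCk.const k _ e.open_target)
      exact HadamardCk.comp (g := hadamardDeriv _) e.open_target hf.deriv hc fun y hy => ⟨⟨hy, trivial⟩, trivial⟩
    · refine (hf.hasHadamardDeriv (x := (y, 0)) ⟨hy, trivial⟩ (0, 1)).tendsto.congr fun t => ?_
      simp [L, h0]
  have hmem : v ∈ genDomain π exp x := by
    obtain ⟨ξ, -, hξ⟩ := key (chartAt E (1 : G)) (chart_mem_atlas E 1)
    have := hξ _ (mem_chart_target E (1 : G))
    rw [(chartAt E (1 : G)).left_inv (mem_chart_source E 1)] at this
    simp only [map_one, Module.End.one_apply] at this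
    exact (gen_eq_of_tendsto h0 this).1
  refine ⟨hmem, fun e he => ?_⟩
  obtain ⟨ξ, hξk, hξ⟩ := key e he
  have heq : EqOn ξ ((fun g => π g (_root_.gen π exp x v)) ∘ e.symm) e.target := fun y hy => by
    have hg : Continuous (π (e.symm y)) := hπ.comp (Continuous.prodMk_right (e.symm y))
    refine tendsto_nhds_unique (hξ y hy) (((hg.tendsto _).comp (tendsto_gen h0 hmem)).congr
      fun t => ?_)
    simp
  simpa using hξk.congr e.open_target heq

omit [IsTopologicalAddGroup V] [ContinuousSMul ℝ V] [LocallyConvexSpace ℝ V] in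
theorem mem_commonDomain_of_isHadamardCkFrom (hexp : IsExponentialFunction E exp)
    (hπ : Continuous (fun p : G × V => π p.1 p.2)) {k : ℕ} :
    ∀ {v : V}, IsHadamardCkFrom E k (fun g => π g v) univ → v ∈ commonDomain π exp k := by
  induction k with
  | zero => exact fun _ => trivial
  | succ k ih =>
    intro v hv
    exact mem_commonDomain_succ.2 ⟨mem_commonDomain_one.2 fun x => (hv.gen hexp hπ x).1,
      fun x => ih (hv.gen hexp hπ x).2⟩

omit [IsLocallyConvexLieGroup E G] in
-- Mean value theorem along `s ↦ π (exp (s • t • q)) v`. The generator of `t • q` is `t` times that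
-- of `q`, cancelling `t⁻¹`, and `exp (s • t • q) → 1` uniformly in `s`. The vectors `v i` need not
-- converge.
theorem tendsto_quotient_exp (hexp : IsExponentialFunction E exp)
    (hπ : Continuous (fun p : G × V => π p.1 p.2)) {α : Type*} {l : Filter α} {t : α → ℝ}
    {q : α → E} {y : E} {v : α → V} {w : V} (ht : Tendsto t l (𝓝[≠] 0)) (hq : Tendsto q l (𝓝 y))
    (hv : ∀ᶠ i in l, ∀ x, v i ∈ genDomain π exp x)
    (hw : Tendsto (fun i => gen π exp (q i) (v i)) l (𝓝 w)) :
    Tendsto (fun i => (t i)⁻¹ • (π (exp (t i • q i)) (v i) - v i)) l (𝓝 w) := by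
  have h0 := hexp.map_zero
  have hec : Continuous exp := continuousOn_univ.1 (isSmoothInto_of_isCkMap hexp.smooth).1
  have htq : Tendsto (fun i => t i • q i) l (𝓝 0) := by
    have := (tendsto_nhds_of_tendsto_nhdsWithin ht).smul hq
    rwa [zero_smul] at this
  have h1 := tendsto_sub_of_hasCurveDeriv (l := l)
    (c := fun i s => (t i)⁻¹ • π (exp (s • (t i • q i))) (v i))
    (c' := fun i s => π (exp (s • (t i • q i))) (gen π exp (q i) (v i))) (y := w) ?_ ?_
  · refine h1.congr fun i => ?_
    simp [h0, smul_sub]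
  · filter_upwards [hv, (tendsto_nhdsWithin_iff.1 ht).2] with i hi hti s _
    have hti : t i ≠ 0 := hti
    have h2 := (hasCurveDeriv_exp hexp hπ (hi (t i • q i)) s).const_smul ((t i)⁻¹)
    rw [gen_smul_left h0 _ (hi _), map_smul, smul_smul, inv_mul_cancel₀ hti, one_smul] at h2
    refine h2.congr fun r => ?_
    rw [smul_comm, smul_sub]
  · have h3 := (hec.tendsto 0).comp (tendsto_smul_zero_of_Icc htq)
    rw [h0] at h3
    have h4 := (hπ.tendsto (1, w)).comp (h3.prodMk_nhds (hw.comp tendsto_fst))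
    simpa [Function.comp_def] using h4

variable [∀ m, BaireSpace (Fin m → E)] [BaireSpace E] [TopologicalSpace.MetrizableSpace V]

/-- If `M` is a continuous multilinear map with values in `𝒟^k`, then `x ↦ π (γ x) M (a x)` is
`C^k` for smooth `γ` and `a`. -/
theorem hadamardCk_orbit {lg : G → E} {S : Set G}
    (hlg : IsLocalLog E exp lg S) (hexp : IsExponentialFunction E exp)
    (hπ : Continuous (fun p : G × V => π p.1 p.2)) :
    ∀ (k : ℕ) {m : ℕ} (M : MultilinearMap ℝ (fun _ : Fin m => E) V) (_ : Continuous M)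
      (_ : ∀ h, M h ∈ commonDomain π exp k) {X : Type u} [AddCommGroup X] [Module ℝ X]
      [TopologicalSpace X] [IsTopologicalAddGroup X] [ContinuousSMul ℝ X]
      {U : Set X} (_ : IsOpen U) {γ : X → G} (_ : IsSmoothInto E γ U) {a : X → Fin m → E}
      (_ : ∀ k, HadamardCk k a U), HadamardCk k (fun x => π (γ x) (M (a x))) U
  | 0, m, M, hM, _, X, _, _, _, _, _, U, _, γ, hγ, a, ha =>
      hπ.comp_continuousOn (hγ.1.prodMk (hM.comp_continuousOn (ha 0)))
  | k + 1, m, M, hM, hMD, X, _, _, _, _, _, U, hU, γ, hγ, a, ha => by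
      have hMD1 : ∀ h, M h ∈ commonDomain π exp 1 := fun h => (mem_commonDomain_succ.1 (hMD h)).1
      obtain ⟨M', hM', hMM'⟩ := exists_multilinearMap_gen hlg hexp hπ M hM hMD1
      obtain ⟨δ, hδ, hδ'⟩ := hlg.exists_logDeriv hU hγ
      have hUU : IsOpen (U ×ˢ (univ : Set X)) := hU.prod isOpen_univ
      have hac : ContinuousOn a U := ha 0
      have hγc := hγ.1
      have hγ1 : IsSmoothInto E (fun p : X × X => γ p.1) (U ×ˢ univ) :=
        hγ.comp_clm hUU (ContinuousLinearMap.fst ℝ X X) fun p hp => hp.1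
      have ha1 : ∀ k, HadamardCk k (fun p : X × X => a p.1) (U ×ˢ univ) := fun k =>
        HadamardCk.comp_clm hUU (ha k) (ContinuousLinearMap.fst ℝ X X) fun p hp => hp.1
      refine HadamardCk.succ_of hU
        (hπ.comp_continuousOn (hγc.prodMk (hM.comp_continuousOn hac)))
        (fun p => π (γ p.1) (M' (Fin.snoc (α := fun _ => E) (a p.1) (δ p))) +
          ∑ i, π (γ p.1) (M (Function.update (a p.1) i (hadamardDeriv a p i)))) ?_ ?_
      · intro x hx h
        obtain ⟨q, hq, hqe⟩ := hδ' x hx h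
        have hx' := tendsto_add_smul x h
        have hg : Continuous (π (γ x)) := hπ.comp (Continuous.prodMk_right (γ x))
        have hax : Tendsto (fun p : ℝ × X => a (x + p.1 • p.2)) (𝓝[≠] 0 ×ˢ 𝓝 h) (𝓝 (a x)) :=
          (hac.continuousAt (hU.mem_nhds hx)).tendsto.comp hx'
        -- The group element moves while the vector is already at its new position `M (a (x + t •
        -- h'))`; the change of the vector is then treated at the fixed group element `γ x`.
        have h1 := tendsto_quotient_exp (π := π) hexp hπ (tendsto_fst (g := 𝓝 h)) hq
          (v := fun p => M (a (x + p.1 • p.2)))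
          (w := M' (Fin.snoc (α := fun _ => E) (a x) (δ (x, h))))
          (.of_forall fun p => mem_commonDomain_one.1 (hMD1 _)) (by
            refine ((hM'.tendsto _).comp (((snocCLM E m).continuous.tendsto
              (a x, δ (x, h))).comp (hax.prodMk_nhds hq))).congr fun p => ?_
            simp [hMM'])
        have h2 := (M.hasHadamardDeriv hM (a x) (hadamardDeriv a (x, h))).comp
          ((ha 1).hasHadamardDeriv hx h)
        have h3 := ((hg.tendsto _).comp h1).add ((hg.tendsto _).comp h2)
        rw [map_sum] at h3
        refine h3.congr' ?_
        filter_upwards [hqe] with p hp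
        simp only [Function.comp_apply]
        rw [hp, map_mul, Module.End.mul_apply, ← map_add, ← smul_add, sub_add_sub_cancel, map_smul,
          map_sub]
      · refine HadamardCk.add hUU ?_ (HadamardCk.sum _ hUU fun i _ => ?_)
        -- Applying a generator costs one level of `𝒟`, so `M'` takes values in `𝒟^k`, exactly what
        -- the induction requires.
        · refine hadamardCk_orbit hlg hexp hπ k M' hM' (fun h => ?_) hUU hγ1
            (a := fun p => Fin.snoc (α := fun _ => E) (a p.1) (δ p))
            (fun k => ((ha1 k).prodMk hUU (hδ k)).clm_comp (snocCLM E m) hUU)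
          rw [hMM']
          exact (mem_commonDomain_succ.1 (hMD _)).2 _
        · exact hadamardCk_orbit hlg hexp hπ k M hM
            (fun h => commonDomain_succ_subset k (hMD h)) hUU hγ1
            (fun k => ((ha1 k).prodMk hUU ((ha (k + 1)).deriv.clm_comp
              (ContinuousLinearMap.proj (R := ℝ) (φ := fun _ : Fin m => E) i) hUU)).clm_comp (updateCLM E i) hUU)

theorem isHadamardCkFrom_of_mem_commonDomain {lg : G → E} {S : Set G}
    (hlg : IsLocalLog E exp lg S) (hexp : IsExponentialFunction E exp)
    (hπ : Continuous (fun p : G × V => π p.1 p.2)) {k : ℕ} {v : V}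
    (hv : v ∈ commonDomain π exp k) : IsHadamardCkFrom E k (fun g => π g v) univ := by
  intro e he
  -- The orbit map is the case `m = 0`: `v` is a multilinear map without arguments and `γ` is the
  -- inverse chart.
  have h := hadamardCk_orbit hlg hexp hπ k (MultilinearMap.constOfIsEmpty ℝ (fun _ : Fin 0 => E) v)
    continuous_const (fun _ => hv) e.open_target (isSmoothInto_chart_symm he) (a := fun _ _ => 0)
    (fun k => HadamardCk.const k 0 e.open_target)
  simpa [Function.comp_def] using h

theorem mem_ckVectors_iff {lg : G → E} {S : Set G}
    (hlg : IsLocalLog E exp lg S) (hexp : IsExponentialFunction E exp)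
    (hπ : Continuous (fun p : G × V => π p.1 p.2)) {k : ℕ∞} {v : V} :
    v ∈ ckVectors E π k ↔ ∀ j : ℕ, (j : ℕ∞) ≤ k → v ∈ commonDomain π exp j := by
  have hc : Continuous fun g => π g v := hπ.comp (Continuous.prodMk_left v)
  have h : v ∈ ckVectors E π k ↔ _ := isCkMapOn_iff_isHadamardCkFrom isOpen_univ
  rw [h]
  refine ⟨fun h j hj => mem_commonDomain_of_isHadamardCkFrom hexp hπ (h.2 j hj), fun h =>
    ⟨hc.continuousOn, fun j hj => isHadamardCkFrom_of_mem_commonDomain hlg hexp hπ (h j hj)⟩⟩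

end Orbits

theorem mainTheorem3 {E G V : Type*}
    -- `E` is a Fréchet space
    [AddCommGroup E] [Module ℝ E] [UniformSpace E] [IsUniformAddGroup E] [ContinuousSMul ℝ E]
    [LocallyConvexSpace ℝ E] [CompleteSpace E] [TopologicalSpace.MetrizableSpace E]
    -- `G` is a locally exponential Lie group modeled on `E`
    [TopologicalSpace G] [T2Space G] [ChartedSpace E G] [Group G] [IsLocallyConvexLieGroup E G]
    (exp : E → G) (hexp : IsLocallyExponential E exp)
    -- `V` is a metrizable locally convex space
    [AddCommGroup V] [Module ℝ V] [TopologicalSpace V] [IsTopologicalAddGroup V]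
    [ContinuousSMul ℝ V] [LocallyConvexSpace ℝ V] [TopologicalSpace.MetrizableSpace V]
    -- `π` is a continuous representation of `G` on `V`
    (π : Representation ℝ G V) (hπ : Continuous (fun p : G × V => π p.1 p.2)) :
    (∀ k : ℕ, 1 ≤ k → commonDomain π exp k = ckVectors E π (k : ℕ∞)) ∧
    (⋂ k : ℕ, ⋂ _ : 1 ≤ k, commonDomain π exp k) = ckVectors E π (⊤ : ℕ∞) := by
  -- With completeness this makes `E` and its finite powers Baire spaces.
  have : (uniformity E).IsCountablyGenerated := IsUniformAddGroup.uniformity_countably_generated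
  obtain ⟨lg, S, hlg⟩ := hexp.exists_isLocalLog
  refine ⟨fun k _ => ?_, ?_⟩
  · ext v
    rw [mem_ckVectors_iff hlg hexp.isExp hπ]
    refine ⟨fun hv j hj => ?_, fun h => h k le_rfl⟩
    have hj : j ≤ k := by exact_mod_cast hj
    exact antitone_nat_of_succ_le (f := commonDomain π exp) commonDomain_succ_subset hj hv
  · ext v
    rw [mem_ckVectors_iff hlg hexp.isExp hπ]
    simp only [mem_iInter]
    refine ⟨fun hv j _ => ?_, fun h k _ => h k le_top⟩
    -- The intersection starts at level `1`; passing through `j + 1` also covers `j = 0`.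
    exact commonDomain_succ_subset j (hv (j + 1) (Nat.le_add_left 1 j))
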